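/- Let $N\ge 0$, $n=\lfloor N/2\rfloor$, and let the index set $X$ be $\{-n,\dots,n\}$ if $N$ is odd and $\{-n,\dots,n\}\setminus\{0\}$ if $N$ is even. Let $V=\mathbb C^N$ with basis $e_i$ $(i\in X)$ and symmetric bilinear form $(e_i,e_j)=\delta_{i,-j}$, with matrix $G=(\delta_{i,-j})$, and let $\mathfrak o_N$ be the Lie algebra of the matrices $f$ with $f^tG+Gf=0$; it contains $F_{ij}=E_{ij}-E_{-j,-i}$. For $I=\{i_1<\dots<i_k\}\subset X$ with $k$ even define in $U(\mathfrak o_N)$ the noncommutative pfaffian $$PfF_I=\frac1{(k/2)!\,2^{k/2}}\sum_{\sigma\in S_k}(-1)^\sigma F_{-i_{\sigma(1)},i_{\sigma(2)}}\cdots F_{-i_{\sigma(k-1)},i_{\sigma(k)}} .$$ Let $\lambda$ be a Young diagram with $m$ places, enumerated by $1,\dots,m$ in some way, and let $c_\lambda$ be the Young symmetrizer on $V^{\otimes m}$ (symmetrize along rows, then antisymmetrize along columns). Let $V^{[m]}\subset V^{\otimes m}$ be the space of traceless tensors, that is, the common kernel of all contractions of two factors by the form. Then $V^{\otimes m}$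 is the direct sum of $V^{[m]}$ and the span of all tensors obtained by inserting $\sum_{a\in X} e_a\otimes e_{-a}$ at two places; let $P$ be the corresponding projection onto $V^{[m]}$. Put $\mathbb S_{[\lambda]}=V^{[m]}\cap c_\lambda(V^{\otimes m})$, which is an $\mathfrak o_N$-submodule of $V^{\otimes m}$. For a tableau $T$ (a filling of $\lambda$ by elements of $X$) with entry $t_p$ at the place $p$ put $v_T=P\,c_\lambda(e_{t_1}\otimes\dots\otimes e_{t_m})$. Then $v_T\in\mathbb S_{[\lambda]}$, and $PfF_I\,v_T$ is found as follows. Call a set $S=\{p_1<\dots<p_{k/2}\}$ of places admissible if the entries $r_2=t_{p_1},\,r_4=t_{p_2},\dots,r_k=t_{p_{k/2}}$ are pairwise different and belong to $I$. For every admissible $S$ there is a permutation $\gamma=\gamma_S$ of $I$ with $\gamma(i_{2j})=r_{2j}$ for $j=1,\dots,k/2$; put $r_{2j-1}=\gamma(i_{2j-1})$, so that $(\gamma(i_1),\dots,\gamma(i_k))=(r_1,\dots,r_k)$. For every choice of such permutations $\gamma_S$, $$PfF_I\,v_T=\sum_{S\ \text{admissible}}(-1)^{\gamma_S}\sum_{\delta\in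 S_{k/2}}(-1)^\delta\, v_{T'_{S,\delta}},$$ where $T'_{S,\delta}$ is obtained from $T$ by replacing, for $j=1,\dots,k/2$, the entry $r_{2j}$ at the place $p_j$ by $-r_{2\delta(j)-1}$. In particular, if there is no admissible $S$, then $PfF_I\,v_T=0$. -/

import Mathlib

open scoped TensorProduct

noncomputable section

attribute [local instance 100] LieRing.ofAssociativeRing

namespace PfaffianTensor

/-! ### The index set and the split orthogonal Lie algebra -/

/-- The index set of `𝔬_N`: the integers `-n, …, n` with `n = ⌊N / 2⌋`, where `0` is left out
when `N` is even. -/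
def indexSet (N : ℕ) : Finset ℤ :=
  (Finset.Icc (-((N / 2 : ℕ) : ℤ)) ((N / 2 : ℕ) : ℤ)).filter (fun i => i = 0 → Odd N)

/-- The type of indices. -/
abbrev Idx (N : ℕ) : Type := ↥(indexSet N)

instance (N : ℕ) : Neg (Idx N) where
  neg i := ⟨-i.1, by
    have h := i.2
    simp only [indexSet, Finset.mem_filter, Finset.mem_Icc] at h ⊢
    refine ⟨⟨by omega, by omega⟩, fun h0 => h.2 (by omega)⟩⟩

theorem Idx.coe_neg {N : ℕ} (i : Idx N) : ((-i : Idx N) : ℤ) = -(i : ℤ) := rfl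

instance (N : ℕ) : InvolutiveNeg (Idx N) where
  neg_neg i := Subtype.ext (by simp [Idx.coe_neg])

/-- The standard space `V`, with basis `e_i`. -/
def V (N : ℕ) : Type := Idx N → ℂ

instance (N : ℕ) : AddCommGroup (V N) := inferInstanceAs (AddCommGroup (Idx N → ℂ))

instance (N : ℕ) : Module ℂ (V N) := inferInstanceAs (Module ℂ (Idx N → ℂ))

/-- The basis vector `e_i` of `V`. -/
def e {N : ℕ} (i : Idx N) : V N := (Pi.single i 1 : Idx N → ℂ)

/-- The matrix `G = (δ_{i,-j})` of the split quadratic form. -/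
def G (N : ℕ) : Matrix (Idx N) (Idx N) ℂ := Matrix.of fun i j => if i = -j then 1 else 0

/-- The orthogonal Lie algebra `𝔬_N` of all matrices `f` with `fᵗ G + G f = 0`. -/
abbrev o (N : ℕ) : LieSubalgebra ℂ (Matrix (Idx N) (Idx N) ℂ) :=
  skewAdjointMatricesLieSubalgebra (G N)

theorem mem_o_iff {N : ℕ} (A : Matrix (Idx N) (Idx N) ℂ) :
    A ∈ o N ↔ A.transpose * G N + G N * A = 0 := by
  rw [mem_skewAdjointMatricesLieSubalgebra, mem_skewAdjointMatricesSubmodule,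
    Matrix.IsSkewAdjoint, Matrix.IsAdjointPair, mul_neg, eq_neg_iff_add_eq_zero]

theorem mem_o_iff_entries {N : ℕ} (A : Matrix (Idx N) (Idx N) ℂ) :
    A ∈ o N ↔ ∀ i j, A (-j) i + A (-i) j = 0 := by
  rw [mem_o_iff, ← Matrix.ext_iff]
  refine forall_congr' fun i => forall_congr' fun j => ?_
  have h1 : (A.transpose * G N) i j = A (-j) i := by
    simp [Matrix.mul_apply, G]
  have h2 : (G N * A) i j = A (-i) j := by
    rw [Matrix.mul_apply, Finset.sum_eq_single (-i)]
    · simp [G]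
    · intro b _ hb
      have : i ≠ -b := fun h => hb (by rw [h, neg_neg])
      simp [G, this]
    · simp
  rw [Matrix.add_apply, h1, h2, Matrix.zero_apply]

/-- The generator `F_{ij} = E_{ij} - E_{-j,-i}` of `𝔬_N`. -/
def F {N : ℕ} (i j : Idx N) : o N :=
  ⟨Matrix.single i j 1 - Matrix.single (-j) (-i) 1, by
    rw [mem_o_iff_entries]
    intro a b
    simp only [Matrix.sub_apply, Matrix.single_apply, neg_inj]
    have h1 : (-j = -b ∧ -i = a) ↔ (i = -a ∧ j = b) := by
      constructor
      · rintro ⟨h, rfl⟩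
        exact ⟨by simp, neg_injective h⟩
      · rintro ⟨rfl, rfl⟩
        simp
    have h2 : (-j = -a ∧ -i = b) ↔ (i = -b ∧ j = a) := by
      constructor
      · rintro ⟨h, rfl⟩
        exact ⟨by simp, neg_injective h⟩
      · rintro ⟨rfl, rfl⟩
        simp
    simp only [neg_inj] at h1 h2
    simp only [h1, h2]
    ring⟩

/-! ### Noncommutative pfaffians -/

/-- The first (odd) position `2j - 1` of the `j`-th pair, in zero-based numbering. -/
def fstPos {h : ℕ} (j : Fin h) : Fin (2 * h) := ⟨2 * j.1, by omega⟩

/-- The second (even) position `2j` of the `j`-th pair, in zero-based numbering. -/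
def sndPos {h : ℕ} (j : Fin h) : Fin (2 * h) := ⟨2 * j.1 + 1, by omega⟩

/-- The noncommutative pfaffian of a matrix `Φ` of size `2h`,
`(1 / (h! 2^h)) ∑_σ (-1)^σ Φ_{σ(1)σ(2)} ⋯ Φ_{σ(2h-1)σ(2h)}`. -/
def pfaffian {R : Type*} [Ring R] [Algebra ℂ R] {h : ℕ}
    (Φ : Matrix (Fin (2 * h)) (Fin (2 * h)) R) : R :=
  ((1 : ℂ) / ((h.factorial : ℂ) * 2 ^ h)) •
    ∑ σ : Equiv.Perm (Fin (2 * h)), ((Equiv.Perm.sign σ : ℤ) : ℂ) •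
      (List.ofFn fun j : Fin h => Φ (σ (fstPos j)) (σ (sndPos j))).prod

/-- For `I = {i_1 < ⋯ < i_k}` with `k = 2h`, the pfaffian
`PfF_I = Pf (F_{-i_a, i_b})_{a,b}` in the universal enveloping algebra `U(𝔬_N)`. -/
def PfF {N h : ℕ} (I : Finset (Idx N)) (hI : I.card = 2 * h) :
    UniversalEnvelopingAlgebra ℂ (o N) :=
  pfaffian (Matrix.of fun a b : Fin (2 * h) =>
    UniversalEnvelopingAlgebra.ι ℂ (F (-(I.orderEmbOfFin hI a)) (I.orderEmbOfFin hI b)))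

/-! ### Tensors and the action of `𝔬_N` -/

/-- Tensors on `V` whose factors are indexed by `ι`. -/
abbrev Tensor (N : ℕ) (ι : Type) : Type := ⨂[ℂ] _ : ι, V N

/-- The operator `1 ⊗ ⋯ ⊗ A ⊗ ⋯ ⊗ 1` with `A` at the place `p`. -/
def atPlace (N : ℕ) {ι : Type} [DecidableEq ι] (p : ι) :
    Module.End ℂ (V N) →ₗ[ℂ] Module.End ℂ (Tensor N ι) :=
  (PiTensorProduct.mapMultilinear ℂ (fun _ : ι => V N) (fun _ : ι => V N)).toLinearMap
    (fun _ => LinearMap.id) p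

theorem atPlace_tprod {N : ℕ} {ι : Type} [DecidableEq ι] (p : ι) (A : Module.End ℂ (V N))
    (v : ι → V N) :
    atPlace N p A (PiTensorProduct.tprod ℂ v) =
      PiTensorProduct.tprod ℂ (Function.update v p (A (v p))) := by
  rw [atPlace, MultilinearMap.toLinearMap_apply, PiTensorProduct.mapMultilinear_apply,
    PiTensorProduct.map_tprod]
  congr 1
  funext q
  by_cases h : q = p
  · subst h
    simp
  · simp [h]

theorem atPlace_lie {N : ℕ} {ι : Type} [DecidableEq ι] (p q : ι) (A B : Module.End ℂ (V N)) :
    ⁅atPlace N p A, atPlace N q B⁆ = if p = q then atPlace N p ⁅A, B⁆ else 0 := by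
  refine PiTensorProduct.ext (MultilinearMap.ext fun v => ?_)
  simp only [LinearMap.compMultilinearMap_apply, Ring.lie_def, LinearMap.sub_apply,
    Module.End.mul_apply, atPlace_tprod]
  split_ifs with h
  · subst h
    simp [map_sub, atPlace_tprod]
  · rw [Function.update_of_ne h, Function.update_of_ne (Ne.symm h), Function.update_comm h,
      sub_self, LinearMap.zero_apply]

/-- The derivation of the tensor space induced by an endomorphism `A` of `V`:
`v_1 ⊗ ⋯ ⊗ v_m ↦ ∑_p v_1 ⊗ ⋯ ⊗ A v_p ⊗ ⋯ ⊗ v_m`. -/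
def derivationAction (N : ℕ) (ι : Type) [Fintype ι] [DecidableEq ι] :
    Module.End ℂ (V N) →ₗ⁅ℂ⁆ Module.End ℂ (Tensor N ι) where
  toLinearMap := ∑ p : ι, atPlace N p
  map_lie' := by
    intro A B
    change (∑ p : ι, atPlace N p) ⁅A, B⁆ = ⁅(∑ p : ι, atPlace N p) A, (∑ p : ι, atPlace N p) B⁆
    rw [LinearMap.sum_apply, LinearMap.sum_apply, LinearMap.sum_apply,
      LieRing.of_associative_ring_bracket (∑ p : ι, atPlace N p A), Finset.sum_mul_sum, Finset.sum_mul_sum]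
    rw [Finset.sum_comm (f := fun i j => atPlace N i B * atPlace N j A), ← Finset.sum_sub_distrib]
    refine Finset.sum_congr rfl fun p _ => ?_
    rw [← Finset.sum_sub_distrib]
    have := fun q => atPlace_lie (N := N) p q A B
    simp only [LieRing.of_associative_ring_bracket] at this ⊢
    simp [this]

theorem derivationAction_tprod {N : ℕ} {ι : Type} [Fintype ι] [DecidableEq ι]
    (A : Module.End ℂ (V N)) (v : ι → V N) :
    derivationAction N ι A (PiTensorProduct.tprod ℂ v) =
      ∑ p : ι, PiTensorProduct.tprod ℂ (Function.update v p (A (v p))) := by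
  change ((∑ p : ι, atPlace N p) A) _ = _
  rw [LinearMap.sum_apply, LinearMap.sum_apply]
  exact Finset.sum_congr rfl fun p _ => atPlace_tprod p A v

/-- The matrices acting on `V`, with `E_{ij} e_j = e_i`. -/
def stdAct (N : ℕ) : Matrix (Idx N) (Idx N) ℂ →ₗ⁅ℂ⁆ Module.End ℂ (V N) :=
  (lieEquivMatrix' (R := ℂ) (n := Idx N)).symm.toLieHom

theorem stdAct_apply {N : ℕ} (A : Matrix (Idx N) (Idx N) ℂ) (v : V N) (i : Idx N) :
    stdAct N A v i = ∑ j, A i j * v j := rfl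

/-- The representation of `𝔬_N` on tensors. -/
def tensorRep (N : ℕ) (ι : Type) [Fintype ι] [DecidableEq ι] :
    o N →ₗ⁅ℂ⁆ Module.End ℂ (Tensor N ι) :=
  ((derivationAction N ι).comp (stdAct N)).comp (o N).incl

instance (N : ℕ) (ι : Type) [Fintype ι] [DecidableEq ι] : LieRingModule (o N) (Tensor N ι) :=
  LieRingModule.compLieHom (Tensor N ι) (tensorRep N ι)

instance (N : ℕ) (ι : Type) [Fintype ι] [DecidableEq ι] : LieModule ℂ (o N) (Tensor N ι) :=
  LieModule.compLieHom (Tensor N ι) (tensorRep N ι)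

theorem lie_tprod {N : ℕ} {ι : Type} [Fintype ι] [DecidableEq ι] (A : o N) (v : ι → V N) :
    ⁅A, PiTensorProduct.tprod ℂ v⁆ =
      ∑ p : ι, PiTensorProduct.tprod ℂ (Function.update v p (stdAct N A.1 (v p))) :=
  derivationAction_tprod _ v

/-- The action of `U(𝔬_N)` on tensors. -/
def envAction (N : ℕ) (ι : Type) [Fintype ι] [DecidableEq ι] :
    UniversalEnvelopingAlgebra ℂ (o N) →ₐ[ℂ] Module.End ℂ (Tensor N ι) :=
  UniversalEnvelopingAlgebra.lift ℂ (LieModule.toEnd ℂ (o N) (Tensor N ι))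

/-! ### Traceless tensors -/

/-- The symmetric bilinear form `(e_i, e_j) = δ_{i,-j}` on `V`. -/
def form (N : ℕ) : V N →ₗ[ℂ] V N →ₗ[ℂ] ℂ := Matrix.toLinearMap₂' ℂ (G N)

theorem form_apply {N : ℕ} (v w : V N) : form N v w = ∑ i, v (-i) * w i := by
  refine (Matrix.toLinearMap₂'_apply (G N) v w).trans ?_
  rw [Finset.sum_comm]
  refine Finset.sum_congr rfl fun i _ => ?_
  simp [G]

/-- The tensor places different from `p` and `q`. -/
abbrev Rest {m : ℕ} (p q : Fin m) : Type := {r : Fin m // r ≠ p ∧ r ≠ q}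

/-- The contraction `v_1 ⊗ ⋯ ⊗ v_m ↦ (v_p, v_q) v_1 ⊗ ⋯ v̂_p ⋯ v̂_q ⋯ ⊗ v_m`. -/
def contraction (N : ℕ) {m : ℕ} (p q : Fin m) (hpq : p ≠ q) :
    Tensor N (Fin m) →ₗ[ℂ] Tensor N (Rest p q) :=
  PiTensorProduct.lift (MultilinearMap.mk'
    (fun v : Fin m → V N => form N (v p) (v q) •
      PiTensorProduct.tprod ℂ (fun r : Rest p q => v r.1))
    (by
      intro v s x y
      by_cases hp : s = p
      · subst hp
        have : ∀ z, (fun r : Rest s q => Function.update v s z r.1) =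
            fun r : Rest s q => v r.1 := fun z => by
          funext r; rw [Function.update_of_ne r.2.1]
        simp only [this, Function.update_self, Function.update_of_ne hpq.symm, map_add,
          LinearMap.add_apply, add_smul]
      · by_cases hq : s = q
        · subst hq
          have : ∀ z, (fun r : Rest p s => Function.update v s z r.1) =
              fun r : Rest p s => v r.1 := fun z => by
            funext r; rw [Function.update_of_ne r.2.2]
          simp only [this, Function.update_self, Function.update_of_ne hpq, map_add, add_smul]
        · have : ∀ z, (fun r : Rest p q => Function.update v s z r.1) =
              Function.update (fun r : Rest p q => v r.1) ⟨s, hp, hq⟩ z := fun z => by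
            funext r
            by_cases hr : r.1 = s
            · obtain ⟨r, hr'⟩ := r
              subst hr
              simp
            · rw [Function.update_of_ne hr, Function.update_of_ne]
              exact fun h => hr (by rw [h])
          simp only [this, Function.update_of_ne (Ne.symm hp), Function.update_of_ne (Ne.symm hq),
            MultilinearMap.map_update_add, smul_add])
    (by
      intro v s c x
      by_cases hp : s = p
      · subst hp
        have : ∀ z, (fun r : Rest s q => Function.update v s z r.1) =
            fun r : Rest s q => v r.1 := fun z => by
          funext r; rw [Function.update_of_ne r.2.1]
        simp only [this, Function.update_self, Function.update_of_ne hpq.symm, map_smul,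
          LinearMap.smul_apply, smul_assoc]
      · by_cases hq : s = q
        · subst hq
          have : ∀ z, (fun r : Rest p s => Function.update v s z r.1) =
              fun r : Rest p s => v r.1 := fun z => by
            funext r; rw [Function.update_of_ne r.2.2]
          simp only [this, Function.update_self, Function.update_of_ne hpq, map_smul, smul_assoc]
        · have : ∀ z, (fun r : Rest p q => Function.update v s z r.1) =
              Function.update (fun r : Rest p q => v r.1) ⟨s, hp, hq⟩ z := fun z => by
            funext r
            by_cases hr : r.1 = s
            · obtain ⟨r, hr'⟩ := r
              subst hr
              simp
            · rw [Function.update_of_ne hr, Function.update_of_ne]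
              exact fun h => hr (by rw [h])
          simp only [this, Function.update_of_ne (Ne.symm hp), Function.update_of_ne (Ne.symm hq),
            MultilinearMap.map_update_smul]
          rw [smul_comm]))

theorem contraction_tprod {N m : ℕ} (p q : Fin m) (hpq : p ≠ q) (v : Fin m → V N) :
    contraction N p q hpq (PiTensorProduct.tprod ℂ v) =
      form N (v p) (v q) • PiTensorProduct.tprod ℂ (fun r : Rest p q => v r.1) := by
  rw [contraction, PiTensorProduct.lift.tprod]
  rfl

/-- The space `V^{[m]}` of traceless tensors: the common kernel of all contractions. -/
def traceless (N m : ℕ) : Submodule ℂ (Tensor N (Fin m)) :=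
  ⨅ (p : Fin m) (q : Fin m) (hpq : p ≠ q), LinearMap.ker (contraction N p q hpq)

/-- The family with `x` at place `p`, `y` at place `q` and `w` at the other places. -/
def insertAt {α : Type} {m : ℕ} (p q : Fin m) (x y : α) (w : Rest p q → α) : Fin m → α :=
  fun r => if hp : r = p then x else if hq : r = q then y else w ⟨r, hp, hq⟩

theorem insertAt_update {α : Type} {m : ℕ} (p q : Fin m) (x y : α) (w : Rest p q → α)
    (s : Rest p q) (z : α) :
    insertAt p q x y (Function.update w s z) = Function.update (insertAt p q x y w) s.1 z := by
  funext r
  by_cases hr : r = s.1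
  · subst hr
    simp [insertAt, s.2.1, s.2.2]
  · rw [Function.update_of_ne hr]
    unfold insertAt
    split_ifs with h1 h2
    · rfl
    · rfl
    · rw [Function.update_of_ne]
      exact fun h => hr (by rw [← h])

/-- The insertion of the invariant tensor `∑_a e_a ⊗ e_{-a}` at the places `p` and `q`. -/
def insertion (N : ℕ) {m : ℕ} (p q : Fin m) :
    Tensor N (Rest p q) →ₗ[ℂ] Tensor N (Fin m) :=
  PiTensorProduct.lift (MultilinearMap.mk'
    (fun w : Rest p q → V N => ∑ a : Idx N,
      PiTensorProduct.tprod ℂ (insertAt p q (e a) (e (-a)) w))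
    (by
      intro w s x y
      simp only [insertAt_update, MultilinearMap.map_update_add, Finset.sum_add_distrib])
    (by
      intro w s c x
      simp only [insertAt_update, MultilinearMap.map_update_smul, Finset.smul_sum]))

theorem insertion_tprod {N m : ℕ} (p q : Fin m) (w : Rest p q → V N) :
    insertion N p q (PiTensorProduct.tprod ℂ w) =
      ∑ a : Idx N, PiTensorProduct.tprod ℂ (insertAt p q (e a) (e (-a)) w) := by
  rw [insertion, PiTensorProduct.lift.tprod]
  rfl

/-- The span of all insertions of the invariant tensor. It is the invariant complement of
`V^{[m]}` in `V^{⊗ m}`. -/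
def traceSpan (N m : ℕ) : Submodule ℂ (Tensor N (Fin m)) :=
  ⨆ (p : Fin m) (q : Fin m) (_ : p ≠ q), LinearMap.range (insertion N p q)

/-- The basis `e_i` of `V`. -/
def stdBasis (N : ℕ) : Module.Basis (Idx N) ℂ (V N) := Pi.basisFun ℂ (Idx N)

theorem stdBasis_apply {N : ℕ} (i : Idx N) : stdBasis N i = e i := Pi.basisFun_apply ℂ (Idx N) i

theorem stdBasis_repr {N : ℕ} (v : V N) (i : Idx N) : (stdBasis N).repr v i = v i := rfl

/-- The basis `e_{t_1} ⊗ ⋯ ⊗ e_{t_m}` of the tensor space. -/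
def tensorBasis (N : ℕ) (ι : Type) [Fintype ι] :
    Module.Basis (ι → Idx N) ℂ (Tensor N ι) :=
  Basis.piTensorProduct fun _ => stdBasis N

theorem tensorBasis_apply {N : ℕ} {ι : Type} [Fintype ι] (t : ι → Idx N) :
    tensorBasis N ι t = PiTensorProduct.tprod ℂ fun i => e (t i) := by
  simp [tensorBasis, stdBasis_apply]

theorem tensorBasis_repr_tprod {N : ℕ} {ι : Type} [Fintype ι] (v : ι → V N) (t : ι → Idx N) :
    (tensorBasis N ι).repr (PiTensorProduct.tprod ℂ v) t = ∏ i, v i (t i) := by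
  simp [tensorBasis, stdBasis_repr]

theorem form_e {N : ℕ} (i j : Idx N) : form N (e i) (e j) = if j = -i then 1 else 0 := by
  rw [form_apply]
  simp only [e, Pi.single_apply]
  rw [Finset.sum_eq_single j]
  · by_cases h : j = -i
    · subst h
      simp
    · have : -j ≠ i := fun h' => h (by rw [← h', neg_neg])
      simp [h, this]
  · intro b _ hb
    simp [hb]
  · simp

/-- The contraction is the transpose of the insertion in the bases of pure basis tensors. -/
theorem repr_contraction {N m : ℕ} (p q : Fin m) (hpq : p ≠ q) (w : Rest p q → Idx N)
    (x : Tensor N (Fin m)) :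
    (tensorBasis N (Rest p q)).repr (contraction N p q hpq x) w =
      ∑ a : Idx N, (tensorBasis N (Fin m)).repr x (insertAt p q a (-a) w) := by
  classical
  have key : ((tensorBasis N (Rest p q)).coord w).comp (contraction N p q hpq) =
      ∑ a : Idx N, (tensorBasis N (Fin m)).coord (insertAt p q a (-a) w) := by
    refine (tensorBasis N (Fin m)).ext fun u => ?_
    rw [LinearMap.comp_apply, tensorBasis_apply, contraction_tprod, form_e, map_smul,
      Module.Basis.coord_apply, ← tensorBasis_apply (ι := Rest p q) (fun r => u r.1),
      Module.Basis.repr_self, LinearMap.sum_apply, ← tensorBasis_apply]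
    simp only [Module.Basis.coord_apply, Module.Basis.repr_self, Finsupp.single_apply]
    have h : ∀ a : Idx N, u = insertAt p q a (-a) w ↔
        (a = u p ∧ (u q = -u p ∧ (fun r : Rest p q => u r.1) = w)) := by
      intro a
      constructor
      · intro hu
        have h1 : u p = a := by rw [hu]; simp [insertAt]
        have h2 : u q = -a := by rw [hu]; simp [insertAt, hpq.symm]
        refine ⟨h1.symm, by rw [h1, h2], ?_⟩
        funext r
        rw [hu]
        simp [insertAt, r.2.1, r.2.2]
      · rintro ⟨rfl, h2, h3⟩
        funext r
        unfold insertAt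
        split_ifs with hp hq
        · rw [hp]
        · rw [hq, h2]
        · rw [← h3]
    simp only [h, ite_and, Finset.sum_ite_eq', Finset.mem_univ, if_true]
    split_ifs <;> simp
  have := LinearMap.congr_fun key x
  simpa using this

/-- Coordinates of a tensor, as a vector of a Hermitian space. -/
def coordEquiv (N m : ℕ) : Tensor N (Fin m) ≃ₗ[ℂ] EuclideanSpace ℂ (Fin m → Idx N) :=
  (tensorBasis N (Fin m)).equivFun.trans (WithLp.linearEquiv 2 ℂ _).symm

theorem coordEquiv_apply {N m : ℕ} (x : Tensor N (Fin m)) (u : Fin m → Idx N) :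
    coordEquiv N m x u = (tensorBasis N (Fin m)).repr x u := rfl

theorem inner_insertion {N m : ℕ} (p q : Fin m) (hpq : p ≠ q) (w : Rest p q → Idx N)
    (x : Tensor N (Fin m)) :
    inner ℂ (coordEquiv N m (insertion N p q (tensorBasis N _ w))) (coordEquiv N m x) =
      (tensorBasis N (Rest p q)).repr (contraction N p q hpq x) w := by
  classical
  have h : ∀ u : Fin m → Idx N,
      coordEquiv N m (tensorBasis N (Fin m) u) = EuclideanSpace.single u 1 := by
    intro u
    ext u'
    rw [coordEquiv_apply, Module.Basis.repr_self]
    simp [Finsupp.single_apply, eq_comm]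
  rw [repr_contraction, tensorBasis_apply, insertion_tprod, map_sum, sum_inner]
  refine Finset.sum_congr rfl fun a _ => ?_
  have h2 : (insertAt p q (e a) (e (-a)) fun i => e (w i)) =
      fun r => e (insertAt p q a (-a) w r) := by
    funext r
    unfold insertAt
    split_ifs <;> rfl
  rw [h2, ← tensorBasis_apply, h, EuclideanSpace.inner_single_left, map_one, one_mul,
    coordEquiv_apply]

theorem isCompl_traceless (N m : ℕ) : IsCompl (traceless N m) (traceSpan N m) := by
  set φ := coordEquiv N m with hφ
  have h : (traceless N m).map φ.toLinearMap = ((traceSpan N m).map φ.toLinearMap)ᗮ := by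
    ext y
    obtain ⟨x, rfl⟩ := φ.surjective y
    have h1 : φ x ∈ (traceless N m).map φ.toLinearMap ↔ x ∈ traceless N m := by
      constructor
      · rintro ⟨z, hz, hzx⟩
        rwa [← φ.injective hzx]
      · intro hx
        exact ⟨x, hx, rfl⟩
    rw [h1, traceSpan]
    simp only [Submodule.map_iSup]
    simp only [← Submodule.iInf_orthogonal, traceless, Submodule.mem_iInf]
    refine forall_congr' fun p => forall_congr' fun q => ?_
    by_cases hpq : p = q
    · simp [hpq]
    simp only [ne_eq, hpq, not_false_eq_true, forall_true_left, iSup_pos]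
    rw [LinearMap.mem_ker, Submodule.mem_orthogonal]
    constructor
    · rintro hx _ ⟨_, ⟨z, rfl⟩, rfl⟩
      rw [← (tensorBasis N (Rest p q)).sum_repr z]
      simp only [map_sum, map_smul, sum_inner, inner_smul_left]
      refine Finset.sum_eq_zero fun w _ => ?_
      have := inner_insertion p q hpq w x
      rw [hx] at this
      simp only [map_zero, Finsupp.coe_zero, Pi.zero_apply] at this
      erw [this]
      simp
    · intro hx
      refine (tensorBasis N (Rest p q)).ext_elem fun w => ?_
      rw [← inner_insertion p q hpq w x, map_zero]
      exact hx _ ⟨_, ⟨_, rfl⟩, rfl⟩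
  have h2 : IsCompl ((traceless N m).map φ.toLinearMap) ((traceSpan N m).map φ.toLinearMap) := by
    rw [h]
    exact (Submodule.isCompl_orthogonal _).symm
  exact ((Submodule.orderIsoMapComap φ).isCompl_iff).2 h2

/-- The projection of `V^{⊗ m}` onto the traceless tensors, along the span of the insertions of
the invariant tensor. -/
def tracelessProj (N m : ℕ) : Module.End ℂ (Tensor N (Fin m)) :=
  (traceless N m).projection (traceSpan N m) (isCompl_traceless N m)

/-! ### Young symmetrizers, the modules `S_[μ]` and the vectors `v_T` -/

/-- The permutation of the tensor factors given by `g`. -/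
def permAction (N : ℕ) {m : ℕ} (g : Equiv.Perm (Fin m)) : Module.End ℂ (Tensor N (Fin m)) :=
  (PiTensorProduct.reindex ℂ (fun _ : Fin m => V N) g).toLinearMap

theorem permAction_tprod {N m : ℕ} (g : Equiv.Perm (Fin m)) (v : Fin m → V N) :
    permAction N g (PiTensorProduct.tprod ℂ v) =
      PiTensorProduct.tprod ℂ (fun i => v (g.symm i)) :=
  PiTensorProduct.reindex_tprod g v

/-- Symmetrization along the rows of the diagram `μ` whose places are enumerated by `num`. -/
def rowSymmetrizer (N : ℕ) (μ : YoungDiagram) (num : Fin μ.card ≃ ↥μ.cells) :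
    Module.End ℂ (Tensor N (Fin μ.card)) :=
  ∑ g : Equiv.Perm (Fin μ.card) with ∀ p, (num (g p)).1.1 = (num p).1.1, permAction N g

/-- Antisymmetrization along the columns of the diagram `μ`. -/
def colAntisymmetrizer (N : ℕ) (μ : YoungDiagram) (num : Fin μ.card ≃ ↥μ.cells) :
    Module.End ℂ (Tensor N (Fin μ.card)) :=
  ∑ g : Equiv.Perm (Fin μ.card) with ∀ p, (num (g p)).1.2 = (num p).1.2,
    ((Equiv.Perm.sign g : ℤ) : ℂ) • permAction N g

/-- The Young symmetrizer `c_μ = a_μ b_μ`. The group algebra acts on tensors from the right, so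
the rows are symmetrized first and then the columns are antisymmetrized. -/
def youngSymmetrizer (N : ℕ) (μ : YoungDiagram) (num : Fin μ.card ≃ ↥μ.cells) :
    Module.End ℂ (Tensor N (Fin μ.card)) :=
  colAntisymmetrizer N μ num ∘ₗ rowSymmetrizer N μ num

theorem sum_split {m : ℕ} {M : Type*} [AddCommMonoid M] (p q : Fin m) (hpq : p ≠ q)
    (f : Fin m → M) : ∑ s, f s = f p + f q + ∑ s : Rest p q, f s.1 := by
  rw [← Finset.sum_add_sum_compl {p, q} f, Finset.sum_pair hpq]
  congr 1
  refine Finset.sum_subtype _ (fun x => ?_) f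
  simp

theorem form_invariant {N : ℕ} (A : o N) (v w : V N) :
    form N (stdAct N A.1 v) w + form N v (stdAct N A.1 w) = 0 := by
  have h := (mem_o_iff_entries A.1).1 A.2
  simp only [form_apply, stdAct_apply, Finset.sum_mul, Finset.mul_sum]
  have h1 : ∑ i : Idx N, ∑ j, v (-i) * (A.1 i j * w j) =
      ∑ i : Idx N, ∑ j, v j * (A.1 (-j) i * w i) := by
    rw [Finset.sum_comm]
    refine Finset.sum_congr rfl fun i _ => ?_
    rw [← Equiv.sum_comp (Equiv.neg (Idx N))]
    simp
  rw [h1, ← Finset.sum_add_distrib]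
  refine Finset.sum_eq_zero fun i _ => ?_
  rw [← Finset.sum_add_distrib]
  refine Finset.sum_eq_zero fun j _ => ?_
  have := h i j
  linear_combination v j * w i * this

theorem contraction_lie {N m : ℕ} (p q : Fin m) (hpq : p ≠ q) (A : o N)
    (x : Tensor N (Fin m)) :
    contraction N p q hpq ⁅A, x⁆ = ⁅A, contraction N p q hpq x⁆ := by
  have key : (contraction N p q hpq).comp (LieModule.toEnd ℂ (o N) (Tensor N (Fin m)) A) =
      (LieModule.toEnd ℂ (o N) (Tensor N (Rest p q)) A).comp (contraction N p q hpq) := by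
    refine PiTensorProduct.ext (MultilinearMap.ext fun v => ?_)
    simp only [LinearMap.compMultilinearMap_apply, LinearMap.comp_apply, LieModule.toEnd_apply_apply]
    rw [lie_tprod, map_sum, contraction_tprod, lie_smul, lie_tprod, sum_split p q hpq]
    simp only [contraction_tprod]
    have hp : (fun r : Rest p q => Function.update v p (stdAct N A.1 (v p)) r.1) =
        fun r => v r.1 := by
      funext r; rw [Function.update_of_ne r.2.1]
    have hq : (fun r : Rest p q => Function.update v q (stdAct N A.1 (v q)) r.1) =
        fun r => v r.1 := by
      funext r; rw [Function.update_of_ne r.2.2]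
    rw [hp, hq, Function.update_self, Function.update_self, Function.update_of_ne hpq,
      Function.update_of_ne hpq.symm, ← add_smul, form_invariant, zero_smul, zero_add,
      Finset.smul_sum]
    refine Finset.sum_congr rfl fun s _ => ?_
    rw [Function.update_of_ne s.2.1.symm, Function.update_of_ne s.2.2.symm]
    congr 2
    funext r
    by_cases hr : r = s
    · subst hr
      simp
    · rw [Function.update_of_ne hr, Function.update_of_ne (fun h => hr (Subtype.ext h))]
  exact LinearMap.congr_fun key x

theorem permAction_lie {N m : ℕ} (g : Equiv.Perm (Fin m)) (A : o N) (x : Tensor N (Fin m)) :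
    permAction N g ⁅A, x⁆ = ⁅A, permAction N g x⁆ := by
  have key : (permAction N g).comp (LieModule.toEnd ℂ (o N) (Tensor N (Fin m)) A) =
      (LieModule.toEnd ℂ (o N) (Tensor N (Fin m)) A).comp (permAction N g) := by
    refine PiTensorProduct.ext (MultilinearMap.ext fun v => ?_)
    simp only [LinearMap.compMultilinearMap_apply, LinearMap.comp_apply, LieModule.toEnd_apply_apply]
    rw [lie_tprod, map_sum, permAction_tprod, lie_tprod, ← Equiv.sum_comp g fun s => PiTensorProduct.tprod ℂ
      (Function.update (fun i => v (g.symm i)) s (stdAct N A.1 (v (g.symm s))))]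
    refine Finset.sum_congr rfl fun s _ => ?_
    rw [permAction_tprod, Equiv.symm_apply_apply]
    congr 1
    funext r
    by_cases hr : r = g s
    · subst hr
      simp
    · have : g.symm r ≠ s := fun h => hr (by rw [← h, Equiv.apply_symm_apply])
      rw [Function.update_of_ne hr, Function.update_of_ne this]
  exact LinearMap.congr_fun key x

theorem youngSymmetrizer_lie {N : ℕ} (μ : YoungDiagram) (num : Fin μ.card ≃ ↥μ.cells) (A : o N)
    (x : Tensor N (Fin μ.card)) :
    youngSymmetrizer N μ num ⁅A, x⁆ = ⁅A, youngSymmetrizer N μ num x⁆ := by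
  simp only [youngSymmetrizer, colAntisymmetrizer, rowSymmetrizer, LinearMap.comp_apply,
    LinearMap.sum_apply, LinearMap.smul_apply, permAction_lie, map_sum, lie_sum, lie_smul]

/-- The `𝔬_N`-module `S_[μ] = V^{[m]} ∩ S_μ V`, where `S_μ V` is the image of the Young
symmetrizer. -/
def tracelessSchur (N : ℕ) (μ : YoungDiagram) (num : Fin μ.card ≃ ↥μ.cells) :
    LieSubmodule ℂ (o N) (Tensor N (Fin μ.card)) where
  toSubmodule := traceless N μ.card ⊓ LinearMap.range (youngSymmetrizer N μ num)
  lie_mem := by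
    rintro A x ⟨hx, ⟨y, rfl⟩⟩
    refine ⟨?_, ⟨⁅A, y⁆, youngSymmetrizer_lie μ num A y⟩⟩
    have hx' := hx
    simp only [traceless, SetLike.mem_coe, Submodule.mem_iInf, LinearMap.mem_ker] at hx' ⊢
    intro p q hpq
    rw [contraction_lie, hx' p q hpq, lie_zero]

/-- The vector `v_T` of a tableau `T` with the entries `t_p = T p` at the places `p = 1, …, m`:
the projection of `c_μ (e_{t_1} ⊗ ⋯ ⊗ e_{t_m})` to the traceless tensors. -/
def tableauVector {N : ℕ} (μ : YoungDiagram) (num : Fin μ.card ≃ ↥μ.cells)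
    (T : ↥μ.cells → Idx N) : Tensor N (Fin μ.card) :=
  tracelessProj N μ.card
    (youngSymmetrizer N μ num (PiTensorProduct.tprod ℂ fun p => e (T (num p))))

/-! ### Replacing entries of a tableau -/

/-- A set `S` of places is an admissible choice when it has `h` elements, the entries of `T` at
these places are pairwise different, and all of them lie in `I`. -/
def Admissible {N : ℕ} {μ : YoungDiagram} (num : Fin μ.card ≃ ↥μ.cells) (T : ↥μ.cells → Idx N)
    (I : Finset (Idx N)) (h : ℕ) (S : Finset (Fin μ.card)) : Prop :=
  S.card = h ∧ Set.InjOn (fun p => T (num p)) ↑S ∧ ∀ p ∈ S, T (num p) ∈ I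

/-- For the places `p_1 < ⋯ < p_h` of `S`, the permutation `γ` of `I = {i_1 < ⋯ < i_{2h}}` has
`γ(i_{2j}) = r_{2j}`, where `r_{2j}` is the entry of `T` at `p_j`. -/
def Arranges {N h : ℕ} {μ : YoungDiagram} (num : Fin μ.card ≃ ↥μ.cells) (T : ↥μ.cells → Idx N)
    (I : Finset (Idx N)) (hI : I.card = 2 * h) (S : Finset (Fin μ.card)) (hS : S.card = h)
    (γ : Equiv.Perm ↥I) : Prop :=
  ∀ j : Fin h, (γ (I.orderIsoOfFin hI (sndPos j)) : Idx N) = T (num (S.orderEmbOfFin hS j))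

/-- The tableau obtained from `T` by replacing the entry at the place `p_j` by `-x_j`,
for `j = 1, …, h`, where `p_1 < ⋯ < p_h` are the places of `S`. -/
def replaceEntries {N h : ℕ} {μ : YoungDiagram} (num : Fin μ.card ≃ ↥μ.cells)
    (T : ↥μ.cells → Idx N) (S : Finset (Fin μ.card)) (hS : S.card = h) (x : Fin h → Idx N) :
    ↥μ.cells → Idx N :=
  fun c => if hc : num.symm c ∈ S then -x ((S.orderIsoOfFin hS).symm ⟨num.symm c, hc⟩) else T c

end PfaffianTensor

end

open scoped TensorProduct

noncomputable section

namespace PfaffianTensor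

/-! ### Equivariance of the projection onto the traceless tensors -/

/-! Both $P$ and $c_\lambda$ commute with $\mathfrak o_N$, hence with $PfF_I$, so it suffices to
compute $PfF_I$ on basis tensors.

On tensors $F_{-a,b}$ acts as $\sum_p (E_{-a,b}-E_{-b,a})^{(p)}$, the superscript marking the place.
This is the skew-symmetrization of $X_{ab}=\sum_p E_{-a,b}^{(p)}$. By antisymmetry the $2^h$ choices
of a term in each factor contribute equally, so the pfaffian is $\frac1{h!}$ times an alternating
sum of products of the $X_{ab}$ (`pfaffian_skew`). Expanding these products gives a sum over maps
$f$ from the $h$ pairs to the places.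

If $f$ sends two pairs to one place, the sum over $\sigma$ is zero:
$E_{-a,b}E_{-c,d}=\delta_{b,-c}E_{-a,d}$ is symmetric in $b,c$, while exchanging these two indices
changes the sign of $\sigma$ (`sum_sign_prod_atPlace_eq_zero`). An injective $f$ is a set $S$ of $h$
places with an ordering. Permuting whole pairs is even, so the $h!$ orderings agree and cancel
$1/h!$ (`envAction_PfF_tprod`).

For fixed $S$, a term survives only if $i_{\sigma(2j)}=t_{p_j}$ for all $j$. This forces $S$ to be
admissible, and the surviving $\sigma$ are $\gamma_S$, read on positions, times a permutation
$\delta$ of the odd positions (`sum_sign_of_arranges`). This gives the signs and the new entries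
$-r_{2\delta(j)-1}$. -/

theorem projection_commute {K E : Type*} [Ring K] [AddCommGroup E] [Module K E]
    {p q : Submodule K E} (hpq : IsCompl p q) (L : Module.End K E)
    (hp : ∀ x ∈ p, L x ∈ p) (hq : ∀ x ∈ q, L x ∈ q) (x : E) :
    p.projection q hpq (L x) = L (p.projection q hpq x) := by
  conv_lhs => rw [← Submodule.projection_add_projection_eq_self hpq x, map_add, map_add]
  rw [Submodule.projection_apply_of_mem_left hpq
      (hp _ (Submodule.projection_apply_mem hpq x)),
    Submodule.projection_apply_of_mem_right hpq
      (hq _ (Submodule.projection_apply_mem hpq.symm x)), add_zero]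

theorem mem_traceless_iff {N m : ℕ} (x : Tensor N (Fin m)) :
    x ∈ traceless N m ↔ ∀ p q, ∀ hpq : p ≠ q, contraction N p q hpq x = 0 := by
  simp only [traceless, Submodule.mem_iInf, LinearMap.mem_ker]

theorem traceSpan_invariant {N m : ℕ} (L : Module.End ℂ (Tensor N (Fin m)))
    (hL : ∀ p q, p ≠ q → ∀ y, L (insertion N p q y) ∈ traceSpan N m) :
    ∀ x ∈ traceSpan N m, L x ∈ traceSpan N m := by
  change traceSpan N m ≤ (traceSpan N m).comap L
  conv_lhs => rw [traceSpan]
  refine iSup_le fun p => iSup_le fun q => iSup_le fun hpq => ?_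
  rintro _ ⟨y, rfl⟩
  exact hL p q hpq y

theorem insertion_mem_traceSpan {N m : ℕ} {p q : Fin m} (hpq : p ≠ q)
    (y : Tensor N (Rest p q)) : insertion N p q y ∈ traceSpan N m :=
  (le_iSup_of_le p <| le_iSup_of_le q <| le_iSup_of_le hpq le_rfl :
    LinearMap.range (insertion N p q) ≤ traceSpan N m) ⟨y, rfl⟩

/-- The bijection between the remaining places induced by a permutation of the places. -/
def restEquiv {m : ℕ} (g : Equiv.Perm (Fin m)) (p q : Fin m) : Rest p q ≃ Rest (g p) (g q) :=
  g.subtypeEquiv fun r => by simp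

/-- The reason why permuting the factors preserves the common kernel of all contractions; the
reindexing only relabels the remaining factors. -/
theorem contraction_permAction {N m : ℕ} (g : Equiv.Perm (Fin m)) (p q : Fin m) (hpq : p ≠ q)
    (x : Tensor N (Fin m)) :
    contraction N (g p) (g q) (g.injective.ne hpq) (permAction N g x) =
      PiTensorProduct.reindex ℂ (fun _ => V N) (restEquiv g p q) (contraction N p q hpq x) := by
  have key : (contraction N (g p) (g q) (g.injective.ne hpq)).comp (permAction N g) =
      (PiTensorProduct.reindex ℂ (fun _ => V N) (restEquiv g p q)).toLinearMap.comp
        (contraction N p q hpq) := by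
    refine PiTensorProduct.ext (MultilinearMap.ext fun v => ?_)
    simp only [LinearMap.compMultilinearMap_apply, LinearMap.comp_apply, permAction_tprod,
      contraction_tprod, map_smul, LinearEquiv.coe_coe, Equiv.symm_apply_apply]
    rw [PiTensorProduct.reindex_tprod]
    rfl
  exact LinearMap.congr_fun key x

theorem permAction_insertion {N m : ℕ} (g : Equiv.Perm (Fin m)) (p q : Fin m)
    (y : Tensor N (Rest p q)) :
    permAction N g (insertion N p q y) =
      insertion N (g p) (g q)
        (PiTensorProduct.reindex ℂ (fun _ => V N) (restEquiv g p q) y) := by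
  have key : (permAction N g).comp (insertion N p q) = (insertion N (g p) (g q)).comp
      (PiTensorProduct.reindex ℂ (fun _ => V N) (restEquiv g p q)).toLinearMap := by
    refine PiTensorProduct.ext (MultilinearMap.ext fun w => ?_)
    simp only [LinearMap.compMultilinearMap_apply, LinearMap.comp_apply, insertion_tprod,
      map_sum, permAction_tprod, LinearEquiv.coe_coe]
    rw [PiTensorProduct.reindex_tprod, insertion_tprod]
    refine Finset.sum_congr rfl fun a _ => congrArg _ (funext fun r => ?_)
    simp only [insertAt, Equiv.symm_apply_eq]
    rfl
  exact LinearMap.congr_fun key y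

theorem tracelessProj_permAction {N m : ℕ} (g : Equiv.Perm (Fin m)) (x : Tensor N (Fin m)) :
    tracelessProj N m (permAction N g x) = permAction N g (tracelessProj N m x) := by
  refine projection_commute _ _ (fun x hx => ?_) (traceSpan_invariant _ fun p q hpq y => ?_) x
  · rw [mem_traceless_iff] at hx ⊢
    intro p q hpq
    obtain ⟨p, rfl⟩ := g.surjective p
    obtain ⟨q, rfl⟩ := g.surjective q
    have hpq' : p ≠ q := fun h => hpq (congrArg g h)
    rw [contraction_permAction g p q hpq', hx p q hpq', map_zero]
  · rw [permAction_insertion]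
    exact insertion_mem_traceSpan (g.injective.ne hpq) _

/-- Exhibits $v_T$ as a Young symmetrizer applied to a tensor, so that it lies in both spaces whose
intersection is $\mathbb S_{[\lambda]}$. -/
theorem tracelessProj_youngSymmetrizer {N : ℕ} (μ : YoungDiagram)
    (num : Fin μ.card ≃ ↥μ.cells) (x : Tensor N (Fin μ.card)) :
    tracelessProj N μ.card (youngSymmetrizer N μ num x) =
      youngSymmetrizer N μ num (tracelessProj N μ.card x) := by
  simp only [youngSymmetrizer, colAntisymmetrizer, rowSymmetrizer, LinearMap.comp_apply,
    LinearMap.sum_apply, LinearMap.smul_apply, map_sum, map_smul, tracelessProj_permAction]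

/-! ### Invariance of the trace span under $\mathfrak o_N$. -/

theorem stdAct_e {N : ℕ} (A : Matrix (Idx N) (Idx N) ℂ) (a : Idx N) :
    stdAct N A (e a) = ∑ b, A b a • e b := by
  rw [← (stdBasis N).sum_repr (stdAct N A (e a))]
  refine Finset.sum_congr rfl fun b _ => ?_
  rw [stdBasis_apply, stdBasis_repr, stdAct_apply]
  simp [e, Pi.single_apply]

theorem tprod_insertAt_sum_left {N m : ℕ} (p q : Fin m) (c : Idx N → ℂ) (y : V N)
    (w : Rest p q → V N) :
    PiTensorProduct.tprod ℂ (insertAt p q (∑ b, c b • e b) y w) =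
      ∑ b, c b • PiTensorProduct.tprod ℂ (insertAt p q (e b) y w) := by
  have h : ∀ x, insertAt p q x y w = Function.update (insertAt p q 0 y w) p x := by
    intro x
    funext r
    by_cases hr : r = p
    · subst hr; simp [insertAt]
    · simp [insertAt, hr]
  rw [h, MultilinearMap.map_update_sum]
  refine Finset.sum_congr rfl fun b _ => ?_
  rw [MultilinearMap.map_update_smul, ← h]

/-- Unlike on the left, $p\ne q$ matters: `insertAt` gives precedence to `p`, so for $p=q$ the
second vector would not occur. -/
theorem tprod_insertAt_sum_right {N m : ℕ} (p q : Fin m) (hpq : p ≠ q) (c : Idx N → ℂ) (x : V N)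
    (w : Rest p q → V N) :
    PiTensorProduct.tprod ℂ (insertAt p q x (∑ b, c b • e b) w) =
      ∑ b, c b • PiTensorProduct.tprod ℂ (insertAt p q x (e b) w) := by
  have h : ∀ y, insertAt p q x y w = Function.update (insertAt p q x 0 w) q y := by
    intro y
    funext r
    by_cases hr : r = q
    · subst hr; simp [insertAt, hpq.symm]
    · simp [insertAt, hr]
  rw [h, MultilinearMap.map_update_sum]
  refine Finset.sum_congr rfl fun b _ => ?_
  rw [MultilinearMap.map_update_smul, ← h]

/-- The tensor `∑_a e_a ⊗ e_{-a}` is invariant under `𝔬_N`. -/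
theorem insertion_invariant {N m : ℕ} (p q : Fin m) (hpq : p ≠ q) (A : o N)
    (w : Rest p q → V N) :
    ∑ a : Idx N, PiTensorProduct.tprod ℂ (insertAt p q (stdAct N A.1 (e a)) (e (-a)) w) +
      ∑ a : Idx N, PiTensorProduct.tprod ℂ (insertAt p q (e a) (stdAct N A.1 (e (-a))) w) = 0 := by
  have h := (mem_o_iff_entries A.1).1 A.2
  simp only [stdAct_e, tprod_insertAt_sum_left, tprod_insertAt_sum_right p q hpq]
  -- After renaming, both sums run over $e_b\otimes e_{-a}$, with total coefficient
  -- $A_{b,a}+A_{-a,-b}=0$.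
  have h1 : ∑ a : Idx N, ∑ b, A.1 b (-a) •
        PiTensorProduct.tprod ℂ (insertAt p q (e a) (e b) w) =
      ∑ a : Idx N, ∑ b, A.1 (-a) (-b) •
        PiTensorProduct.tprod ℂ (insertAt p q (e b) (e (-a)) w) := by
    rw [Finset.sum_comm, ← Equiv.sum_comp (Equiv.neg (Idx N))]
    rfl
  rw [h1, ← Finset.sum_add_distrib]
  refine Finset.sum_eq_zero fun a _ => ?_
  rw [← Finset.sum_add_distrib]
  refine Finset.sum_eq_zero fun b _ => ?_
  have := h a (-b)
  rw [neg_neg] at this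
  rw [← add_smul, this, zero_smul]

/-- In the Leibniz sum the terms at $p$ and $q$ cancel by `insertion_invariant`; the others are the
action on the remaining factors. -/
theorem insertion_lie {N m : ℕ} (p q : Fin m) (hpq : p ≠ q) (A : o N)
    (y : Tensor N (Rest p q)) :
    ⁅A, insertion N p q y⁆ = insertion N p q ⁅A, y⁆ := by
  have key : (LieModule.toEnd ℂ (o N) (Tensor N (Fin m)) A).comp (insertion N p q) =
      (insertion N p q).comp (LieModule.toEnd ℂ (o N) (Tensor N (Rest p q)) A) := by
    refine PiTensorProduct.ext (MultilinearMap.ext fun w => ?_)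
    simp only [LinearMap.compMultilinearMap_apply, LinearMap.comp_apply,
      LieModule.toEnd_apply_apply]
    rw [insertion_tprod, lie_sum, lie_tprod, map_sum]
    simp only [lie_tprod, insertion_tprod, sum_split p q hpq, Finset.sum_add_distrib]
    have hp : ∀ a : Idx N, Function.update (insertAt p q (e a) (e (-a)) w) p
        (stdAct N A.1 (insertAt p q (e a) (e (-a)) w p)) =
        insertAt p q (stdAct N A.1 (e a)) (e (-a)) w := by
      intro a
      funext r
      by_cases hr : r = p
      · subst hr; simp [insertAt]
      · simp [insertAt, hr]
    have hq : ∀ a : Idx N, Function.update (insertAt p q (e a) (e (-a)) w) q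
        (stdAct N A.1 (insertAt p q (e a) (e (-a)) w q)) =
        insertAt p q (e a) (stdAct N A.1 (e (-a))) w := by
      intro a
      funext r
      by_cases hr : r = q
      · subst hr; simp [insertAt, hpq.symm]
      · simp [insertAt, hr]
    simp only [hp, hq, insertion_invariant p q hpq A w, zero_add]
    rw [Finset.sum_comm]
    refine Finset.sum_congr rfl fun s _ => Finset.sum_congr rfl fun a _ => ?_
    rw [insertAt_update]
    simp [insertAt, s.2.1, s.2.2]
  exact LinearMap.congr_fun key y

theorem tracelessProj_lie {N m : ℕ} (A : o N) (x : Tensor N (Fin m)) :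
    tracelessProj N m ⁅A, x⁆ = ⁅A, tracelessProj N m x⁆ := by
  refine projection_commute _ (LieModule.toEnd ℂ (o N) (Tensor N (Fin m)) A) (fun x hx => ?_)
    (traceSpan_invariant _ fun p q hpq y => ?_) x
  · rw [mem_traceless_iff] at hx ⊢
    intro p q hpq
    rw [LieModule.toEnd_apply_apply, contraction_lie, hx p q hpq, lie_zero]
  · rw [LieModule.toEnd_apply_apply, insertion_lie p q hpq]
    exact insertion_mem_traceSpan hpq _

theorem tableauVector_mem {N : ℕ} (μ : YoungDiagram) (num : Fin μ.card ≃ ↥μ.cells)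
    (T : ↥μ.cells → Idx N) : tableauVector μ num T ∈ tracelessSchur N μ num :=
  ⟨Submodule.projection_apply_mem _ _, ⟨_, (tracelessProj_youngSymmetrizer μ num _).symm⟩⟩

/-! ### Alternating sums over pairings -/

/-- The positions `1, …, 2h`, grouped into `h` pairs. -/
def pairEquiv (h : ℕ) : Fin h × Bool ≃ Fin (2 * h) where
  toFun x := if x.2 then sndPos x.1 else fstPos x.1
  invFun a := (⟨a.1 / 2, by omega⟩, decide (a.1 % 2 = 1))
  left_inv := by
    rintro ⟨j, b⟩
    cases b
    · simp [fstPos]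
    · simp only [sndPos, if_true, Prod.mk.injEq, Fin.ext_iff, decide_eq_true_eq]
      omega
  right_inv := by
    intro a
    by_cases ha : a.1 % 2 = 1
    · simp only [ha, decide_true, if_true, sndPos, Fin.ext_iff]
      omega
    · simp only [ha, decide_false, Bool.false_eq_true, if_false, fstPos, Fin.ext_iff]
      omega

theorem pairEquiv_false {h : ℕ} (j : Fin h) : pairEquiv h (j, false) = fstPos j := rfl

theorem pairEquiv_true {h : ℕ} (j : Fin h) : pairEquiv h (j, true) = sndPos j := rfl

/-- An alternating sum over permutations changes by a sign under a change of the positions. -/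
theorem sum_sign_smul_comp_pairPerm {M : Type*} [AddCommGroup M] [Module ℂ M] {h : ℕ}
    (τ : Equiv.Perm (Fin h × Bool)) (Ψ : Equiv.Perm (Fin (2 * h)) → M) :
    ∑ σ : Equiv.Perm (Fin (2 * h)), ((Equiv.Perm.sign σ : ℤ) : ℂ) •
        Ψ (σ * (pairEquiv h).permCongr τ) =
      ((Equiv.Perm.sign τ : ℤ) : ℂ) •
        ∑ σ : Equiv.Perm (Fin (2 * h)), ((Equiv.Perm.sign σ : ℤ) : ℂ) • Ψ σ := by
  rw [← Equiv.sum_comp (Equiv.mulRight ((pairEquiv h).permCongr τ))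
    fun σ => ((Equiv.Perm.sign σ : ℤ) : ℂ) • Ψ σ, Finset.smul_sum]
  refine Finset.sum_congr rfl fun σ _ => ?_
  rw [Equiv.coe_mulRight, Equiv.Perm.sign_mul, Equiv.Perm.sign_permCongr, smul_smul]
  congr 1
  -- The sign of `τ` occurs squared on the right.
  rcases Int.units_eq_one_or (Equiv.Perm.sign τ) with h1 | h1 <;> simp [h1]

theorem permCongr_pairEquiv {h : ℕ} (τ : Equiv.Perm (Fin h × Bool)) (x : Fin h × Bool) :
    (pairEquiv h).permCongr τ (pairEquiv h x) = pairEquiv h (τ x) := by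
  simp [Equiv.permCongr_apply]

/-- The noncommutative pfaffian of a matrix that is skew-symmetrized from `X`. -/
theorem pfaffian_skew {R : Type*} [Ring R] [Algebra ℂ R] {h : ℕ}
    (X : Fin (2 * h) → Fin (2 * h) → R) :
    pfaffian (Matrix.of fun a b => X a b - X b a) =
      ((1 : ℂ) / (h.factorial : ℂ)) •
        ∑ σ : Equiv.Perm (Fin (2 * h)), ((Equiv.Perm.sign σ : ℤ) : ℂ) •
          (List.ofFn fun j : Fin h => X (σ (fstPos j)) (σ (sndPos j))).prod := by
  -- `s j` records whether the $j$-th factor contributes $X_{ab}$ or $-X_{ba}$.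
  have expand : ∀ σ : Equiv.Perm (Fin (2 * h)),
      (List.ofFn fun j : Fin h => X (σ (fstPos j)) (σ (sndPos j)) -
        X (σ (sndPos j)) (σ (fstPos j))).prod =
      ∑ s : Fin h → Bool, (∏ j, if s j then (-1 : ℂ) else 1) •
        (List.ofFn fun j : Fin h => if s j then X (σ (sndPos j)) (σ (fstPos j)) else
          X (σ (fstPos j)) (σ (sndPos j))).prod := by
    intro σ
    simp only [← MultilinearMap.mkPiAlgebraFin_apply (R := ℂ), ← MultilinearMap.map_smul_univ]
    rw [← MultilinearMap.map_sum (MultilinearMap.mkPiAlgebraFin ℂ h R)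
      (fun j (b : Bool) => (if b then (-1 : ℂ) else 1) •
        if b then X (σ (sndPos j)) (σ (fstPos j)) else X (σ (fstPos j)) (σ (sndPos j)))]
    congr 1
    funext j
    simp [sub_eq_neg_add]
  rw [pfaffian]
  simp only [Matrix.of_apply, expand, Finset.smul_sum (s := (Finset.univ : Finset (Fin h → Bool)))]
  rw [Finset.sum_comm]
  have each : ∀ s : Fin h → Bool,
      ∑ σ : Equiv.Perm (Fin (2 * h)), ((Equiv.Perm.sign σ : ℤ) : ℂ) •
        (∏ j, if s j then (-1 : ℂ) else 1) •
        (List.ofFn fun j : Fin h => if s j then X (σ (sndPos j)) (σ (fstPos j)) else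
          X (σ (fstPos j)) (σ (sndPos j))).prod =
      ∑ σ : Equiv.Perm (Fin (2 * h)), ((Equiv.Perm.sign σ : ℤ) : ℂ) •
          (List.ofFn fun j : Fin h => X (σ (fstPos j)) (σ (sndPos j))).prod := by
    intro s
    -- Exchanging the two positions in each pair selected by `s` has sign $\prod_j(\pm1)$, exactly
    -- the sign that comes with `s`; hence all $2^h$ choices give the same sum.
    set τ : Equiv.Perm (Fin h × Bool) :=
      Equiv.prodCongrRight fun j => if s j then Equiv.swap false true else 1 with hτ
    have hsign : ((Equiv.Perm.sign τ : ℤ) : ℂ) = ∏ j, if s j then (-1 : ℂ) else 1 := by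
      rw [hτ, Equiv.Perm.sign_prodCongrRight]
      push_cast
      refine Finset.prod_congr rfl fun j _ => ?_
      split_ifs <;> simp
    have hterm : ∀ σ : Equiv.Perm (Fin (2 * h)),
        (List.ofFn fun j : Fin h => if s j then X (σ (sndPos j)) (σ (fstPos j)) else
          X (σ (fstPos j)) (σ (sndPos j))).prod =
        (List.ofFn fun j : Fin h => X ((σ * (pairEquiv h).permCongr τ) (fstPos j))
          ((σ * (pairEquiv h).permCongr τ) (sndPos j))).prod := by
      intro σ
      congr 2
      funext j
      simp only [Equiv.Perm.mul_apply, ← pairEquiv_false, ← pairEquiv_true, permCongr_pairEquiv]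
      by_cases hj : s j <;> simp [hτ, hj]
    simp only [hterm, smul_comm _ (∏ j, if s j then (-1 : ℂ) else 1)]
    rw [← Finset.smul_sum, sum_sign_smul_comp_pairPerm τ fun σ =>
      (List.ofFn fun j : Fin h => X (σ (fstPos j)) (σ (sndPos j))).prod, ← hsign, smul_smul]
    rcases Int.units_eq_one_or (Equiv.Perm.sign τ) with h1 | h1 <;> simp [h1]
  simp only [each]
  rw [Finset.sum_const, Finset.card_univ, Fintype.card_fun, Fintype.card_bool, Fintype.card_fin,
    ← Nat.cast_smul_eq_nsmul ℂ, smul_smul]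
  congr 1
  push_cast
  have h2 : (2 : ℂ) ^ h ≠ 0 := pow_ne_zero _ two_ne_zero
  field_simp

/-! ### Products of one-place operators -/

/-- A noncommutative product does not change when two of its factors, separated by ones, are
replaced by factors with the same product. -/
theorem prod_ofFn_congr_pair {R : Type*} [Monoid R] {h : ℕ} (u u' : Fin h → R) {j k : Fin h}
    (hjk : j < k) (hne : ∀ l, l ≠ j → l ≠ k → u l = u' l)
    (hone : ∀ l, j < l → l < k → u l = 1) (hprod : u j * u k = u' j * u' k) :
    (List.ofFn u).prod = (List.ofFn u').prod := by
  rw [List.ofFn_eq_map, List.ofFn_eq_map]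
  have hs := List.pairwise_lt_finRange h
  -- The index list is cut as `a ++ j :: b ++ k :: c`. Outside `j` and `k` the factors agree, and
  -- over `b` they are all 1, so the factors at `j` and `k` meet.
  obtain ⟨a, l, hl⟩ := List.append_of_mem (List.mem_finRange j)
  have hk : k ∈ List.finRange h := List.mem_finRange k
  rw [hl] at hs hk ⊢
  rw [List.pairwise_append, List.pairwise_cons] at hs
  obtain ⟨-, ⟨hjl, hsl⟩, hal⟩ := hs
  have hkl : k ∈ l := by
    rcases List.mem_append.1 hk with hk | hk
    · exact absurd (hal k hk j (by simp)) hjk.asymm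
    · rcases List.mem_cons.1 hk with hk | hk
      · exact absurd hk hjk.ne'
      · exact hk
  obtain ⟨b, c, rfl⟩ := List.append_of_mem hkl
  rw [List.pairwise_append, List.pairwise_cons] at hsl
  obtain ⟨-, ⟨hkc, -⟩, hbc⟩ := hsl
  have ha : a.map u = a.map u' := List.map_congr_left fun x hx => by
    have hxj := hal x hx j (by simp)
    exact hne x hxj.ne (hxj.trans hjk).ne
  have hc : c.map u = c.map u' := List.map_congr_left fun x hx => by
    have hkx := hkc x hx
    exact hne x (hjk.trans hkx).ne' hkx.ne'
  have hb1 : ∀ x ∈ b, u x = 1 := fun x hx =>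
    hone x (hjl x (by simp [hx])) (hbc x hx k (by simp))
  have hb2 : ∀ x ∈ b, u' x = 1 := fun x hx => by
    rw [← hne x (hjl x (by simp [hx])).ne' (hbc x hx k (by simp)).ne, hb1 x hx]
  have hb : (b.map u).prod = 1 := List.prod_eq_one fun y hy => by
    obtain ⟨x, hx, rfl⟩ := List.mem_map.1 hy
    exact hb1 x hx
  have hb' : (b.map u').prod = 1 := List.prod_eq_one fun y hy => by
    obtain ⟨x, hx, rfl⟩ := List.mem_map.1 hy
    exact hb2 x hx
  simp only [List.map_append, List.map_cons, List.prod_append, List.prod_cons, ha, hc, hb, hb',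
    one_mul]
  rw [← mul_assoc (u j), hprod, mul_assoc]

/-- Through this monoid homomorphism, products of one-place operators can be computed place by
place. -/
theorem atPlace_eq_map {N : ℕ} {ι : Type} [DecidableEq ι] (p : ι) (A : Module.End ℂ (V N)) :
    atPlace N p A = PiTensorProduct.mapMonoidHom (Pi.mulSingle p A : ι → Module.End ℂ (V N)) := by
  refine PiTensorProduct.ext (MultilinearMap.ext fun v => ?_)
  simp only [LinearMap.compMultilinearMap_apply, atPlace_tprod, PiTensorProduct.mapMonoidHom_apply,
    PiTensorProduct.map_tprod]
  congr 1
  funext q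
  by_cases hq : q = p
  · subst hq
    simp
  · simp [hq]

theorem prod_atPlace {N h : ℕ} {ι : Type} [DecidableEq ι] (f : Fin h → ι)
    (A : Fin h → Module.End ℂ (V N)) :
    (List.ofFn fun j => atPlace N (f j) (A j)).prod =
      PiTensorProduct.map fun p => (List.ofFn fun j => if f j = p then A j else 1).prod := by
  simp only [atPlace_eq_map]
  have h1 : (List.ofFn fun j => PiTensorProduct.mapMonoidHom (R := ℂ)
      (Pi.mulSingle (f j) (A j) : ι → Module.End ℂ (V N))) =
      (List.ofFn fun j => (Pi.mulSingle (f j) (A j) : ι → Module.End ℂ (V N))).map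
        PiTensorProduct.mapMonoidHom := by
    rw [List.map_ofFn]; rfl
  rw [h1, ← map_list_prod, PiTensorProduct.mapMonoidHom_apply]
  congr 1
  funext p
  refine (map_list_prod (Pi.evalMonoidHom (fun _ : ι => Module.End ℂ (V N)) p) _).trans ?_
  rw [List.map_ofFn]
  congr 2
  funext j
  simp [Pi.mulSingle_apply, eq_comm]

/-- One-place operators at different places act on the factors separately. -/
theorem prod_atPlace_tprod {N h : ℕ} {ι : Type} [DecidableEq ι] (f : Fin h → ι)
    (hf : Function.Injective f) (A : Fin h → Module.End ℂ (V N)) (v : ι → V N) :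
    (List.ofFn fun j => atPlace N (f j) (A j)).prod (PiTensorProduct.tprod ℂ v) =
      PiTensorProduct.tprod ℂ (Function.extend f (fun j => A j (v (f j))) v) := by
  rw [prod_atPlace, PiTensorProduct.map_tprod]
  congr 1
  funext p
  rw [List.ofFn_eq_map]
  by_cases hp : ∃ j, f j = p
  · obtain ⟨j, rfl⟩ := hp
    rw [hf.extend_apply, List.prod_map_eq_pow_single j]
    · simp [List.count_eq_one_of_mem (List.nodup_finRange h) (List.mem_finRange j)]
    · intro k hk _
      rw [if_neg (hf.ne hk)]
  · rw [Function.extend_apply' _ _ _ hp, List.prod_eq_one, Module.End.one_apply]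
    intro x hx
    obtain ⟨j, -, rfl⟩ := List.mem_map.1 hx
    exact if_neg fun h => hp ⟨j, h⟩

/-- The alternating sum of products of one-place operators vanishes if two of them act at the same
place, provided that `E a b * E c d` is symmetric in `b` and `c`. -/
theorem sum_sign_prod_atPlace_eq_zero {N h : ℕ} {ι : Type} [DecidableEq ι] (f : Fin h → ι)
    (hf : ¬ Function.Injective f) (E : Fin (2 * h) → Fin (2 * h) → Module.End ℂ (V N))
    (hE : ∀ a b c d, E a b * E c d = E a c * E b d) :
    ∑ σ : Equiv.Perm (Fin (2 * h)), ((Equiv.Perm.sign σ : ℤ) : ℂ) •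
      (List.ofFn fun j : Fin h => atPlace N (f j) (E (σ (fstPos j)) (σ (sndPos j)))).prod = 0 := by
  have hex : ∃ k, ∃ j, j < k ∧ f j = f k := by
    simp only [Function.Injective, not_forall] at hf
    obtain ⟨a, b, hab, hne⟩ := hf
    rcases lt_or_gt_of_ne hne with hlt | hlt
    · exact ⟨b, a, hlt, hab⟩
    · exact ⟨a, b, hlt, hab.symm⟩
  -- With `k` the least index that repeats an earlier place, no index strictly between `j` and `k`
  -- acts there, so the two factors are adjacent in the product at that place.
  obtain ⟨k, ⟨j, hjk, hfjk⟩, hmin⟩ :=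
    WellFounded.has_min (wellFounded_lt (α := Fin h)) {k | ∃ j, j < k ∧ f j = f k} hex
  have hbetween : ∀ l, j < l → l < k → f l ≠ f k := fun l hjl hlk hl =>
    hmin l ⟨j, hjl, by rw [hfjk, hl]⟩ hlk
  -- This exchanges the inner indices $b,c$ of $E_{ab}E_{cd}$: the product is unchanged by `hE`, but
  -- the sign flips, so the sum equals its negative.
  set τ : Equiv.Perm (Fin h × Bool) := Equiv.swap (j, true) (k, false) with hτ
  have hsign : ((Equiv.Perm.sign τ : ℤ) : ℂ) = -1 := by
    rw [hτ, Equiv.Perm.sign_swap (by simp)]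
    simp
  have hinv : ∀ σ : Equiv.Perm (Fin (2 * h)),
      (List.ofFn fun i : Fin h => atPlace N (f i)
        (E ((σ * (pairEquiv h).permCongr τ) (fstPos i))
          ((σ * (pairEquiv h).permCongr τ) (sndPos i)))).prod =
      (List.ofFn fun i : Fin h => atPlace N (f i) (E (σ (fstPos i)) (σ (sndPos i)))).prod := by
    intro σ
    rw [prod_atPlace, prod_atPlace]
    congr 1
    funext p
    simp only [Equiv.Perm.mul_apply, ← pairEquiv_false, ← pairEquiv_true, permCongr_pairEquiv]
    have hother : ∀ l, l ≠ j → l ≠ k → ∀ b, τ (l, b) = (l, b) := fun l hl hl' b =>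
      Equiv.swap_apply_of_ne_of_ne (by simp [hl]) (by simp [hl'])
    by_cases hp : f k = p
    · subst hp
      refine prod_ofFn_congr_pair _ _ hjk (fun l hl hl' => ?_) (fun l hl hl' => ?_) ?_
      · rw [hother l hl hl', hother l hl hl']
      · rw [if_neg (hbetween l hl hl')]
      · rw [if_pos hfjk, if_pos rfl, if_pos hfjk, if_pos rfl, hτ, Equiv.swap_apply_left,
          Equiv.swap_apply_right, Equiv.swap_apply_of_ne_of_ne (by simp) (by simp [hjk.ne]),
          Equiv.swap_apply_of_ne_of_ne (by simp [hjk.ne']) (by simp), hE]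
    · congr 2
      funext l
      by_cases hl : f l = p
      · rw [if_pos hl, if_pos hl, hother l, hother l]
        all_goals
          rintro rfl
          first
          | exact hp hl
          | exact hp (hfjk ▸ hl)
      · rw [if_neg hl, if_neg hl]
  have key := sum_sign_smul_comp_pairPerm τ fun σ =>
    (List.ofFn fun i : Fin h => atPlace N (f i) (E (σ (fstPos i)) (σ (sndPos i)))).prod
  simp only [hinv, hsign, neg_smul, one_smul] at key
  rw [eq_neg_iff_add_eq_zero, ← two_smul ℂ] at key
  exact (smul_eq_zero.1 key).resolve_left two_ne_zero

/-! ### The action of the pfaffian on basis tensors -/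

/-- The matrix unit `E_{ab}`, acting on `V`. -/
def unitEnd {N : ℕ} (a b : Idx N) : Module.End ℂ (V N) := stdAct N (Matrix.single a b 1)

theorem unitEnd_e {N : ℕ} (a b c : Idx N) :
    unitEnd a b (e c) = if b = c then e a else 0 := by
  rw [unitEnd, stdAct_e]
  simp only [Matrix.single_apply]
  split_ifs with h
  · simp [h]
  · simp [h]

theorem unitEnd_mul {N : ℕ} (a b c d : Idx N) :
    unitEnd a b * unitEnd c d = if b = c then unitEnd a d else 0 := by
  refine (stdBasis N).ext fun x => ?_
  rw [stdBasis_apply, Module.End.mul_apply, unitEnd_e]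
  split_ifs with h1 h2 h2 <;> simp [unitEnd_e, h1, h2]

/-- Shows the action of $F_{-a,b}$ in the skew-symmetrized form that `pfaffian_skew` requires. -/
theorem toEnd_F {N m : ℕ} (a b : Idx N) :
    LieModule.toEnd ℂ (o N) (Tensor N (Fin m)) (F (-a) b) =
      ∑ p, atPlace N p (unitEnd (-a) b) - ∑ p, atPlace N p (unitEnd (-b) a) := by
  refine PiTensorProduct.ext (MultilinearMap.ext fun v => ?_)
  simp only [LinearMap.compMultilinearMap_apply, LieModule.toEnd_apply_apply,
    LinearMap.sub_apply, LinearMap.sum_apply]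
  rw [lie_tprod, ← Finset.sum_sub_distrib]
  refine Finset.sum_congr rfl fun p _ => ?_
  rw [← LinearMap.sub_apply, ← map_sub, atPlace_tprod]
  simp [F, unitEnd]

theorem envAction_PfF {N h m : ℕ} (I : Finset (Idx N)) (hI : I.card = 2 * h) :
    envAction N (Fin m) (PfF I hI) = pfaffian (Matrix.of fun a b : Fin (2 * h) =>
      LieModule.toEnd ℂ (o N) (Tensor N (Fin m))
        (F (-(I.orderEmbOfFin hI a)) (I.orderEmbOfFin hI b))) := by
  rw [PfF, pfaffian, pfaffian, map_smul, map_sum]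
  congr 1
  refine Finset.sum_congr rfl fun σ _ => ?_
  rw [map_smul, map_list_prod, List.map_ofFn]
  congr 3
  funext j
  simp only [Function.comp_apply, Matrix.of_apply, envAction]
  exact UniversalEnvelopingAlgebra.lift_ι_apply ℂ _ _

theorem envAction_PfF_eq_sum {N h m : ℕ} (I : Finset (Idx N)) (hI : I.card = 2 * h) :
    envAction N (Fin m) (PfF I hI) = ((1 : ℂ) / (h.factorial : ℂ)) •
      ∑ f : Fin h → Fin m, ∑ σ : Equiv.Perm (Fin (2 * h)), ((Equiv.Perm.sign σ : ℤ) : ℂ) •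
        (List.ofFn fun j : Fin h => atPlace N (f j)
          (unitEnd (-(I.orderEmbOfFin hI (σ (fstPos j))))
            (I.orderEmbOfFin hI (σ (sndPos j))))).prod := by
  rw [envAction_PfF]
  simp only [toEnd_F]
  rw [pfaffian_skew fun a b => ∑ p, atPlace N p
    (unitEnd (-(I.orderEmbOfFin hI a)) (I.orderEmbOfFin hI b)), Finset.sum_comm]
  congr 1
  refine Finset.sum_congr rfl fun σ _ => ?_
  rw [← Finset.smul_sum]
  congr 1
  simp only [← MultilinearMap.mkPiAlgebraFin_apply (R := ℂ)]
  exact MultilinearMap.map_sum (MultilinearMap.mkPiAlgebraFin ℂ h _) fun j p =>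
    atPlace N p (unitEnd (-(I.orderEmbOfFin hI (σ (fstPos j)))) (I.orderEmbOfFin hI (σ (sndPos j))))

/-- A sum over maps that vanishes on non-injective maps is a sum over the images of the maps and
over the orderings of the images. -/
theorem sum_eq_sum_orderEmb {M : Type*} [AddCommMonoid M] {h m : ℕ} (g : (Fin h → Fin m) → M)
    (hg : ∀ f, ¬ Function.Injective f → g f = 0) :
    ∑ f, g f = ∑ S : {S : Finset (Fin m) // S.card = h}, ∑ π : Equiv.Perm (Fin h),
      g (S.1.orderEmbOfFin S.2 ∘ π) := by
  rw [← Fintype.sum_prod_type']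
  refine (Fintype.sum_of_injective
    (fun x : {S : Finset (Fin m) // S.card = h} × Equiv.Perm (Fin h) =>
      (x.1.1.orderEmbOfFin x.1.2 ∘ x.2 : Fin h → Fin m)) ?_ _ _ ?_ fun _ => rfl).symm
  · rintro ⟨⟨S, hS⟩, π⟩ ⟨⟨S', hS'⟩, π'⟩ heq
    have hSS : S = S' := by
      have := congrArg Set.range heq
      simp only [EquivLike.range_comp, Finset.range_orderEmbOfFin] at this
      exact_mod_cast this
    subst hSS
    simp only [Prod.mk.injEq, true_and]
    refine Equiv.ext fun j => (S.orderEmbOfFin hS).injective (congrFun heq j)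
  · intro f hf
    refine hg f fun hinj => hf ?_
    have hS : (Finset.univ.image f).card = h := by
      rw [Finset.card_image_of_injective _ hinj, Finset.card_univ, Fintype.card_fin]
    -- `u j` is the rank of `f j` in the image of `f`; it is the ordering `π` that recovers `f`.
    let u : Fin h → Fin h := fun j => ((Finset.univ.image f).orderIsoOfFin hS).symm
      ⟨f j, Finset.mem_image_of_mem f (Finset.mem_univ j)⟩
    have hu : Function.Injective u := fun a b hab => by
      have := ((Finset.univ.image f).orderIsoOfFin hS).symm.injective hab
      exact hinj (congrArg Subtype.val this)
    refine ⟨⟨⟨_, hS⟩, Equiv.ofBijective u (Finite.injective_iff_bijective.1 hu)⟩, ?_⟩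
    funext j
    simp [u, ← Finset.coe_orderIsoOfFin_apply]

theorem extend_comp_perm {α β γ : Type*} {f : α → β} (hf : Function.Injective f) (π : Equiv.Perm α)
    (g : α → γ) (v : β → γ) :
    Function.extend (f ∘ π) (g ∘ π) v = Function.extend f g v := by
  funext b
  by_cases hb : ∃ a, f a = b
  · obtain ⟨a, rfl⟩ := hb
    rw [hf.extend_apply]
    have := (hf.comp π.injective).extend_apply (g ∘ π) v (π.symm a)
    simpa using this
  · rw [Function.extend_apply' _ _ _ hb, Function.extend_apply']
    rintro ⟨a, ha⟩
    exact hb ⟨π a, ha⟩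

theorem envAction_PfF_tprod {N h m : ℕ} (I : Finset (Idx N)) (hI : I.card = 2 * h)
    (v : Fin m → V N) :
    envAction N (Fin m) (PfF I hI) (PiTensorProduct.tprod ℂ v) =
      ∑ S : {S : Finset (Fin m) // S.card = h}, ∑ σ : Equiv.Perm (Fin (2 * h)),
        ((Equiv.Perm.sign σ : ℤ) : ℂ) •
          PiTensorProduct.tprod ℂ (Function.extend (S.1.orderEmbOfFin S.2)
            (fun j => unitEnd (-(I.orderEmbOfFin hI (σ (fstPos j))))
              (I.orderEmbOfFin hI (σ (sndPos j))) (v (S.1.orderEmbOfFin S.2 j))) v) := by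
  rw [envAction_PfF_eq_sum, sum_eq_sum_orderEmb]
  swap
  · intro f hf
    refine sum_sign_prod_atPlace_eq_zero f hf
      (fun a b => unitEnd (-(I.orderEmbOfFin hI a)) (I.orderEmbOfFin hI b)) fun a b c d => ?_
    simp only [unitEnd_mul]
    -- Both products are $E_{-i_a,i_d}$ or 0, under the equivalent conditions $i_b=-i_c$ and
    -- $i_c=-i_b$.
    refine if_congr ?_ rfl rfl
    rw [eq_comm, neg_eq_iff_eq_neg]
  have hS : ∀ S : {S : Finset (Fin m) // S.card = h}, ∀ π : Equiv.Perm (Fin h),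
      (∑ σ : Equiv.Perm (Fin (2 * h)), ((Equiv.Perm.sign σ : ℤ) : ℂ) •
        (List.ofFn fun j : Fin h => atPlace N ((S.1.orderEmbOfFin S.2 ∘ π) j)
          (unitEnd (-(I.orderEmbOfFin hI (σ (fstPos j))))
            (I.orderEmbOfFin hI (σ (sndPos j))))).prod) (PiTensorProduct.tprod ℂ v) =
      ∑ σ : Equiv.Perm (Fin (2 * h)), ((Equiv.Perm.sign σ : ℤ) : ℂ) •
          PiTensorProduct.tprod ℂ (Function.extend (S.1.orderEmbOfFin S.2)
            (fun j => unitEnd (-(I.orderEmbOfFin hI (σ (fstPos j))))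
              (I.orderEmbOfFin hI (σ (sndPos j))) (v (S.1.orderEmbOfFin S.2 j))) v) := by
    intro S π
    have hinj := (S.1.orderEmbOfFin S.2).injective
    -- Acting by `π` on both members of the pairs has sign $(-1)^\pi(-1)^\pi=1$, so every ordering
    -- of `S` gives the same contribution.
    set τ : Equiv.Perm (Fin h × Bool) := Equiv.prodCongrLeft fun _ : Bool => π with hτ
    have hsign : Equiv.Perm.sign τ = 1 := by
      rw [hτ, Equiv.Perm.sign_prodCongrLeft, Fintype.prod_bool, Int.units_mul_self]
    have key := sum_sign_smul_comp_pairPerm τ fun σ =>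
      (List.ofFn fun j : Fin h => atPlace N ((S.1.orderEmbOfFin S.2 ∘ π) j)
          (unitEnd (-(I.orderEmbOfFin hI (σ (fstPos j))))
            (I.orderEmbOfFin hI (σ (sndPos j))))).prod
    rw [hsign, Units.val_one, Int.cast_one, one_smul] at key
    rw [← key, LinearMap.sum_apply]
    refine Finset.sum_congr rfl fun σ _ => ?_
    rw [LinearMap.smul_apply, prod_atPlace_tprod _ (hinj.comp π.injective),
      ← extend_comp_perm hinj π]
    congr 4
    funext j
    simp only [Equiv.Perm.mul_apply, ← pairEquiv_false, ← pairEquiv_true, permCongr_pairEquiv]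
    simp [hτ]
  simp only [LinearMap.smul_apply, LinearMap.sum_apply _ _ (PiTensorProduct.tprod ℂ v)] at hS ⊢
  simp only [hS, Finset.sum_const, Finset.card_univ, Fintype.card_perm, Fintype.card_fin]
  rw [Finset.smul_sum]
  refine Finset.sum_congr rfl fun S _ => ?_
  rw [← Nat.cast_smul_eq_nsmul ℂ, smul_smul, one_div, inv_mul_cancel₀, one_smul]
  exact Nat.cast_ne_zero.2 h.factorial_ne_zero

/-! ### Admissible sets of places -/

/-- Admissibility makes $2j\mapsto r_{2j}$ an injection of the even positions into $I$, and since
$I$ has $2h$ elements it extends to a bijection from all positions. -/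
theorem exists_arranges {N h : ℕ} {μ : YoungDiagram} (num : Fin μ.card ≃ ↥μ.cells)
    (T : ↥μ.cells → Idx N) (I : Finset (Idx N)) (hI : I.card = 2 * h)
    (S : Finset (Fin μ.card)) (hS : Admissible num T I h S) :
    ∃ γ, Arranges num T I hI S hS.1 γ := by
  obtain ⟨g, hg⟩ := Set.MapsTo.exists_equiv_extend_of_card_eq (α := Fin (2 * h)) (t := I)
    (by rw [Fintype.card_fin, hI]) (s := Set.range (sndPos (h := h)))
    -- Only the values at second positions matter here; the others are chosen by the extension.
    (f := fun a => T (num (S.orderEmbOfFin hS.1 ((pairEquiv h).symm a).1)))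
    (by
      rintro _ ⟨j, rfl⟩
      exact hS.2.2 _ (S.orderEmbOfFin_mem hS.1 _))
    (by
      rintro _ ⟨j, rfl⟩ _ ⟨k, rfl⟩ hjk
      simp only [← pairEquiv_true, Equiv.symm_apply_apply] at hjk ⊢
      have := hS.2.1 (S.orderEmbOfFin_mem hS.1 j) (S.orderEmbOfFin_mem hS.1 k) hjk
      rw [(S.orderEmbOfFin hS.1).injective this])
  refine ⟨(I.orderIsoOfFin hI).toEquiv.symm.trans g, fun j => ?_⟩
  have := hg (sndPos j) ⟨j, rfl⟩
  rw [← pairEquiv_true, Equiv.symm_apply_apply] at this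
  rw [← pairEquiv_true, ← this]
  simp

/-- The permutation of the positions that permutes the first members of the pairs. -/
def fstPerm {h : ℕ} (δ : Equiv.Perm (Fin h)) : Equiv.Perm (Fin h × Bool) :=
  Equiv.prodCongrLeft fun b : Bool => if b then 1 else δ

theorem fstPerm_false {h : ℕ} (δ : Equiv.Perm (Fin h)) (j : Fin h) :
    fstPerm δ (j, false) = (δ j, false) := by simp [fstPerm]

theorem fstPerm_true {h : ℕ} (δ : Equiv.Perm (Fin h)) (j : Fin h) :
    fstPerm δ (j, true) = (j, true) := by simp [fstPerm]

theorem sign_fstPerm {h : ℕ} (δ : Equiv.Perm (Fin h)) :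
    Equiv.Perm.sign (fstPerm δ) = Equiv.Perm.sign δ := by
  rw [fstPerm, Equiv.Perm.sign_prodCongrLeft, Fintype.prod_bool]
  simp

theorem fstPerm_injective {h : ℕ} : Function.Injective (fstPerm (h := h)) := by
  intro δ δ' hδ
  refine Equiv.ext fun j => ?_
  have := congrArg (fun τ : Equiv.Perm (Fin h × Bool) => (τ (j, false)).1) hδ
  simpa only [fstPerm_false] using this

/-- The second members are already taken as values, so injectivity forces first members to go to
first members. -/
theorem exists_fstPerm_eq {h : ℕ} (τ : Equiv.Perm (Fin h × Bool))
    (hτ : ∀ j, τ (j, true) = (j, true)) : ∃ δ, fstPerm δ = τ := by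
  have hfalse : ∀ j, (τ (j, false)).2 = false := by
    intro j
    by_contra hj
    rw [Bool.not_eq_false] at hj
    have h1 : τ (j, false) = τ ((τ (j, false)).1, true) := by
      rw [hτ, ← hj]
    simpa using τ.injective h1
  let u : Fin h → Fin h := fun j => (τ (j, false)).1
  have hu : Function.Injective u := fun a b hab => by
    have h1 : τ (a, false) = τ (b, false) := Prod.ext hab (by rw [hfalse, hfalse])
    simpa using τ.injective h1
  refine ⟨Equiv.ofBijective u (Finite.injective_iff_bijective.1 hu), Equiv.ext ?_⟩
  rintro ⟨j, b⟩
  cases b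
  · rw [fstPerm_false]
    exact Prod.ext rfl (hfalse j).symm
  · rw [fstPerm_true, hτ]

theorem replaceEntries_orderEmb {N h : ℕ} {μ : YoungDiagram} (num : Fin μ.card ≃ ↥μ.cells)
    (T : ↥μ.cells → Idx N) (S : Finset (Fin μ.card)) (hS : S.card = h) (x : Fin h → Idx N)
    (j : Fin h) : replaceEntries num T S hS x (num (S.orderEmbOfFin hS j)) = -x j := by
  rw [replaceEntries, dif_pos (by simp)]
  congr 2
  rw [OrderIso.symm_apply_eq]
  simp [Subtype.ext_iff]

theorem replaceEntries_of_notMem {N h : ℕ} {μ : YoungDiagram} (num : Fin μ.card ≃ ↥μ.cells)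
    (T : ↥μ.cells → Idx N) (S : Finset (Fin μ.card)) (hS : S.card = h) (x : Fin h → Idx N)
    {p : Fin μ.card} (hp : p ∉ S) : replaceEntries num T S hS x (num p) = T (num p) := by
  rw [replaceEntries, dif_neg (by simpa using hp)]

/-- The basis tensor of a filling with the entries at the places of `S` acted on by matrix units. -/
theorem tprod_extend_unitEnd {N h : ℕ} {μ : YoungDiagram} (num : Fin μ.card ≃ ↥μ.cells)
    (T : ↥μ.cells → Idx N) (S : Finset (Fin μ.card)) (hS : S.card = h) (x y : Fin h → Idx N) :
    (PiTensorProduct.tprod ℂ (Function.extend (S.orderEmbOfFin hS)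
      (fun j => unitEnd (-x j) (y j) (e (T (num (S.orderEmbOfFin hS j)))))
      (fun p => e (T (num p)))) : Tensor N (Fin μ.card)) =
      open scoped Classical in
      if ∀ j, y j = T (num (S.orderEmbOfFin hS j)) then
        PiTensorProduct.tprod ℂ fun p => e (replaceEntries num T S hS x (num p)) else 0 := by
  have hinj := (S.orderEmbOfFin hS).injective
  split_ifs with hy
  · congr 1
    funext p
    by_cases hp : p ∈ S
    · have hp' : p ∈ Set.range (S.orderEmbOfFin hS) := by
        rw [Finset.range_orderEmbOfFin]
        exact hp
      obtain ⟨j, rfl⟩ := hp'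
      rw [hinj.extend_apply, replaceEntries_orderEmb, unitEnd_e, if_pos (hy j)]
    · rw [replaceEntries_of_notMem num T S hS x hp, Function.extend_apply']
      rintro ⟨j, rfl⟩
      exact hp (S.orderEmbOfFin_mem hS j)
  · push Not at hy
    obtain ⟨j, hj⟩ := hy
    -- One mismatched entry is killed by its matrix unit, and with it the whole tensor.
    refine MultilinearMap.map_coord_zero _ (S.orderEmbOfFin hS j) ?_
    rw [hinj.extend_apply, unitEnd_e, if_neg hj]

/-- The $i_{\sigma(2j)}$ are distinct elements of $I$, so a surviving term would make `S`
admissible. -/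
theorem not_forall_eq_of_not_admissible {N h : ℕ} {μ : YoungDiagram} (num : Fin μ.card ≃ ↥μ.cells)
    (T : ↥μ.cells → Idx N) (I : Finset (Idx N)) (hI : I.card = 2 * h)
    (S : Finset (Fin μ.card)) (hS : S.card = h) (hadm : ¬ Admissible num T I h S)
    (σ : Equiv.Perm (Fin (2 * h))) :
    ¬ ∀ j, I.orderEmbOfFin hI (σ (sndPos j)) = T (num (S.orderEmbOfFin hS j)) := by
  intro hσ
  have hmem : ∀ p ∈ S, ∃ j, S.orderEmbOfFin hS j = p := fun p hp => by
    have : p ∈ Set.range (S.orderEmbOfFin hS) := by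
      rw [Finset.range_orderEmbOfFin]
      exact hp
    exact this
  refine hadm ⟨hS, ?_, ?_⟩
  · intro p hp q hq hpq
    obtain ⟨j, rfl⟩ := hmem p hp
    obtain ⟨k, rfl⟩ := hmem q hq
    simp only [← hσ] at hpq
    have h1 := σ.injective ((I.orderEmbOfFin hI).injective hpq)
    rw [← pairEquiv_true, ← pairEquiv_true] at h1
    have h2 := congrArg Prod.fst ((pairEquiv h).injective h1)
    exact congrArg _ h2
  · intro p hp
    obtain ⟨j, rfl⟩ := hmem p hp
    rw [← hσ]
    exact I.orderEmbOfFin_mem hI _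

/-- The contribution of an admissible set of places to the action of the pfaffian. -/
theorem sum_sign_of_arranges {N h : ℕ} {μ : YoungDiagram} (num : Fin μ.card ≃ ↥μ.cells)
    (T : ↥μ.cells → Idx N) (I : Finset (Idx N)) (hI : I.card = 2 * h)
    (S : Finset (Fin μ.card)) (hS : S.card = h) (γ : Equiv.Perm ↥I)
    (hγ : Arranges num T I hI S hS γ) :
    ∑ σ : Equiv.Perm (Fin (2 * h)), ((Equiv.Perm.sign σ : ℤ) : ℂ) •
      (PiTensorProduct.tprod ℂ (Function.extend (S.orderEmbOfFin hS)
        (fun j => unitEnd (-(I.orderEmbOfFin hI (σ (fstPos j))))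
          (I.orderEmbOfFin hI (σ (sndPos j))) (e (T (num (S.orderEmbOfFin hS j)))))
        (fun p => e (T (num p)))) : Tensor N (Fin μ.card)) =
    ((Equiv.Perm.sign γ : ℤ) : ℂ) •
      ∑ δ : Equiv.Perm (Fin h), ((Equiv.Perm.sign δ : ℤ) : ℂ) •
        PiTensorProduct.tprod ℂ fun p => e (replaceEntries num T S hS
          (fun j => (γ (I.orderIsoOfFin hI (fstPos (δ j))) : Idx N)) (num p)) := by
  classical
  -- `σ₀` is `γ` transported from $I$ to positions, with the same sign.
  set σ₀ : Equiv.Perm (Fin (2 * h)) := (I.orderIsoOfFin hI).toEquiv.symm.permCongr γ with hσ₀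
  have hσ₀_apply : ∀ a, I.orderEmbOfFin hI (σ₀ a) = γ (I.orderIsoOfFin hI a) := by
    intro a
    rw [← Finset.coe_orderIsoOfFin_apply]
    simp [hσ₀, Equiv.permCongr_apply]
  rw [Finset.smul_sum]
  symm
  refine Fintype.sum_of_injective
    (fun δ => σ₀ * (pairEquiv h).permCongr (fstPerm δ)) ?_ _ _ ?_ ?_
  · exact (mul_right_injective σ₀).comp ((pairEquiv h).permCongr.injective.comp fstPerm_injective)
  · intro σ hσ
    rw [tprod_extend_unitEnd num T S hS (fun j => I.orderEmbOfFin hI (σ (fstPos j)))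
      (fun j => I.orderEmbOfFin hI (σ (sndPos j))), if_neg, smul_zero]
    intro hfix
    have hfix' : ∀ j, σ (sndPos j) = σ₀ (sndPos j) := fun j =>
      (I.orderEmbOfFin hI).injective (by rw [hfix j, hσ₀_apply, hγ j])
    -- If the term of `σ` survives, `σ` and `σ₀` agree on even positions, so `σ₀⁻¹ * σ` only
    -- permutes odd ones.
    obtain ⟨δ, hδ⟩ := exists_fstPerm_eq ((pairEquiv h).symm.permCongr (σ₀⁻¹ * σ)) fun j => by
      rw [Equiv.permCongr_apply, Equiv.symm_symm, pairEquiv_true, Equiv.Perm.mul_apply, hfix',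
        ← Equiv.Perm.mul_apply, inv_mul_cancel, Equiv.Perm.one_apply, ← pairEquiv_true,
        Equiv.symm_apply_apply]
    refine hσ ⟨δ, ?_⟩
    simp only [hδ]
    ext a
    simp [Equiv.permCongr_apply]
  · intro δ
    simp only [Equiv.Perm.mul_apply, ← pairEquiv_false, ← pairEquiv_true, permCongr_pairEquiv,
      fstPerm_false, fstPerm_true]
    rw [tprod_extend_unitEnd num T S hS
      (fun j => I.orderEmbOfFin hI (σ₀ (pairEquiv h (δ j, false))))
      (fun j => I.orderEmbOfFin hI (σ₀ (pairEquiv h (j, true)))), if_pos, smul_smul]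
    · have hsign : Equiv.Perm.sign σ₀ = Equiv.Perm.sign γ := Equiv.Perm.sign_permCongr _ _
      rw [Equiv.Perm.sign_mul, hsign, Equiv.Perm.sign_permCongr, sign_fstPerm]
      simp only [hσ₀_apply]
      push_cast
      rfl
    · intro j
      rw [hσ₀_apply, pairEquiv_true, hγ j]

/-! ### From basis tensors to tableau vectors. -/

/-- $PfF_I$ acts as a polynomial in operators from $\mathfrak o_N$, so whatever commutes with these
commutes with it. -/
theorem envAction_commute {N h m : ℕ} (I : Finset (Idx N)) (hI : I.card = 2 * h)
    (L : Module.End ℂ (Tensor N (Fin m))) (hL : ∀ (A : o N) x, L ⁅A, x⁆ = ⁅A, L x⁆)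
    (x : Tensor N (Fin m)) :
    envAction N (Fin m) (PfF I hI) (L x) = L (envAction N (Fin m) (PfF I hI) x) := by
  have hc : Commute L (envAction N (Fin m) (PfF I hI)) := by
    rw [envAction_PfF, pfaffian]
    refine (Commute.sum_right _ _ _ fun σ _ =>
      (Commute.list_prod_right _ _ fun y hy => ?_).smul_right _).smul_right _
    obtain ⟨j, rfl⟩ := (List.mem_ofFn' _ _).1 hy
    exact LinearMap.ext fun z => hL _ z
  exact (LinearMap.congr_fun hc.eq x).symm

theorem envAction_PfF_tableauVector {N h : ℕ} (I : Finset (Idx N)) (hI : I.card = 2 * h)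
    (μ : YoungDiagram) (num : Fin μ.card ≃ ↥μ.cells) (T : ↥μ.cells → Idx N)
    [Fintype {S : Finset (Fin μ.card) // Admissible num T I h S}]
    (γ : Finset (Fin μ.card) → Equiv.Perm ↥I)
    (hγ : ∀ S, ∀ hS : Admissible num T I h S, Arranges num T I hI S hS.1 (γ S)) :
    envAction N (Fin μ.card) (PfF I hI) (tableauVector μ num T) =
      ∑ S : {S : Finset (Fin μ.card) // Admissible num T I h S},
        ((Equiv.Perm.sign (γ S.1) : ℤ) : ℂ) •
          ∑ δ : Equiv.Perm (Fin h), ((Equiv.Perm.sign δ : ℤ) : ℂ) •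
            tableauVector μ num (replaceEntries num T S.1 S.2.1
              (fun j => (γ S.1 (I.orderIsoOfFin hI (fstPos (δ j))) : Idx N))) := by
  classical
  set L : Module.End ℂ (Tensor N (Fin μ.card)) :=
    tracelessProj N μ.card ∘ₗ youngSymmetrizer N μ num with hLdef
  have hT : ∀ T' : ↥μ.cells → Idx N, tableauVector μ num T' =
      L (PiTensorProduct.tprod ℂ fun p => e (T' (num p))) := fun _ => rfl
  simp only [hT]
  rw [envAction_commute I hI L fun A x => by
    simp only [hLdef, LinearMap.comp_apply, youngSymmetrizer_lie, tracelessProj_lie]]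
  simp only [← map_smul, ← map_sum]
  congr 1
  rw [envAction_PfF_tprod]
  symm
  -- The sum over admissible sets is extended to all sets of `h` places, the added terms being zero.
  refine Fintype.sum_of_injective
    (fun S : {S : Finset (Fin μ.card) // Admissible num T I h S} =>
      (⟨S.1, S.2.1⟩ : {S : Finset (Fin μ.card) // S.card = h})) ?_ _ _ ?_ ?_
  · intro S S' hSS
    exact Subtype.ext (Subtype.mk.inj hSS)
  · rintro ⟨S, hS⟩ hadm
    refine Finset.sum_eq_zero fun σ _ => ?_
    rw [tprod_extend_unitEnd num T S hS (fun j => I.orderEmbOfFin hI (σ (fstPos j)))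
      (fun j => I.orderEmbOfFin hI (σ (sndPos j))), if_neg, smul_zero]
    exact not_forall_eq_of_not_admissible num T I hI S hS (fun h' => hadm ⟨⟨S, h'⟩, rfl⟩) σ
  · rintro ⟨S, hS⟩
    exact (sum_sign_of_arranges num T I hI S hS.1 (γ S) (hγ S hS)).symm

end PfaffianTensor

end

open PfaffianTensor in
open scoped Classical in
theorem mainTheorem6 (N h : ℕ) (I : Finset (Idx N)) (hI : I.card = 2 * h)
    (μ : YoungDiagram) (num : Fin μ.card ≃ ↥μ.cells) (T : ↥μ.cells → Idx N) :
    tableauVector μ num T ∈ tracelessSchur N μ num ∧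
    (∀ S, ∀ hS : Admissible num T I h S, ∃ γ, Arranges num T I hI S hS.1 γ) ∧
    (∀ γ : Finset (Fin μ.card) → Equiv.Perm ↥I,
      (∀ S, ∀ hS : Admissible num T I h S, Arranges num T I hI S hS.1 (γ S)) →
      envAction N (Fin μ.card) (PfF I hI) (tableauVector μ num T) =
        ∑ S : {S : Finset (Fin μ.card) // Admissible num T I h S},
          ((Equiv.Perm.sign (γ S.1) : ℤ) : ℂ) •
            ∑ δ : Equiv.Perm (Fin h), ((Equiv.Perm.sign δ : ℤ) : ℂ) •
              tableauVector μ num (replaceEntries num T S.1 S.2.1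
                (fun j => (γ S.1 (I.orderIsoOfFin hI (fstPos (δ j))) : Idx N)))) ∧
    ((¬ ∃ S, Admissible num T I h S) →
      envAction N (Fin μ.card) (PfF I hI) (tableauVector μ num T) = 0) := by
  refine ⟨tableauVector_mem μ num T, exists_arranges num T I hI,
    envAction_PfF_tableauVector I hI μ num T, fun hno => ?_⟩
  have : IsEmpty {S : Finset (Fin μ.card) // Admissible num T I h S} :=
    ⟨fun S => hno ⟨S.1, S.2⟩⟩
  -- With no admissible set the condition on `γ` is vacuous, so the constant family of identities
  -- serves and the sum is empty.
  rw [envAction_PfF_tableauVector I hI μ num T 1 fun S hS => absurd ⟨S, hS⟩ hno,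
    Fintype.sum_empty]
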